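/- Let $p>2$ be real. There is $c_0=c_0(p)>0$ such that for every $c\in(0,c_0)$ there is exactly one positive function $U_c\in C^\infty((-\infty,0])$ with $$U_c^{p}\,U_c''+U_c^{p+1}-U_c+c\,U_c'=0\quad\text{on }(-\infty,0],\qquad \lim_{\xi\to-\infty}U_c(\xi)=0,$$ and (i) $U_c'(\xi)>0$ for all $\xi\in(-\infty,0)$; (ii) $U_c'(0)=0$ (derivatives at $0$ are one-sided). This $U_c$ moreover satisfies (iii) $U_c'(\xi)\le\lambda_c\,U_c(\xi)$ for all $\xi\in(-\infty,0]$, for some constant $\lambda_c>0$ depending only on $c$ and $p$. The function $c\mapsto U_c(0)$ is strictly decreasing on $(0,c_0)$, and $U_c(0)\to\infty$ as $c\downarrow0$. Finally, for all $\delta>0$ and $A>0$ there is $c_1=c_1(\delta,A)\in(0,c_0]$ such that for every $c\in(0,c_1)$ $$U_c(0)>\delta^{-1},\qquad\text{and}\qquad U_c'(\xi)>A\ \text{ for every }\xi\in(-\infty,0]\text{ with }\delta\le U_c(\xi)\le\delta^{-1}.$$ -/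

import Mathlib

open Set Filter Topology
open scoped ContDiff

/-- `U` (only its values on `(-∞, 0]` matter) is a positive solution, smooth up to the end point
`0`, of `U ^ p U'' + U ^ (p + 1) - U + c U' = 0` on `(-∞, 0]` with `U (-∞) = 0`, with `U' > 0` on
`(-∞, 0)` and with `U' (0) = 0`. Derivatives are taken within `(-∞, 0]`, hence one-sided at `0`. -/
structure IsSpiralProfile (p c : ℝ) (U : ℝ → ℝ) : Prop where
  smooth : ContDiffOn ℝ ∞ U (Iic 0)
  pos : ∀ ξ ≤ 0, 0 < U ξ
  ode : ∀ ξ ≤ 0,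
    U ξ ^ p * derivWithin (derivWithin U (Iic 0)) (Iic 0) ξ + U ξ ^ (p + 1) - U ξ
      + c * derivWithin U (Iic 0) ξ = 0
  tendsto_zero : Tendsto U atBot (𝓝 0)
  deriv_pos : ∀ ξ < 0, 0 < derivWithin U (Iic 0) ξ
  deriv_zero : derivWithin U (Iic 0) 0 = 0

/-! In the phase plane with `v = u'`, a profile is an orbit that emanates from `u = 0`, stays in `v
> 0`, and first meets `v = 0` at the height `U 0`. An orbit above the line `v = u / c` would hit `u
= 0` in finite backward time, so every profile satisfies `U' ≤ U / c`; this is the bound (iii), with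
constant `1 / c`.

Uniqueness and monotonicity use the height `u` as independent variable. The energy `e = U' ^ 2`
solves the first-order equation `e' = 2 (u ^ (1 - p) - u - c u ^ (-p) √e)`. Its damping term
prevents a positive excess of one energy over another from growing with `u` when the damping is at
least as strong; going back to `u = 0`, where `e ≤ (u / c) ^ 2` vanishes, rules such an excess out.
Thus `e`, and with it the maximal height, decreases with `c`, and for equal `c` the energies agree;
time is then recovered from `dτ/du = 1 / √e` (`IsPhaseCurve.energy_le_energy`,
`IsPhaseCurve.top_lt_top`, `IsPhaseCurve.eqOn`).

For existence, trajectories are started at `(a, a / c)` and followed until `v = 0`. Barriers keep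
`v` large: with `r = (16 c ^ 2) ^ (1 / p)`, `v ≥ u / (8 c)` up to `u = r`, `v ≥ r / (16 c)` from
there to `u = 1`, and then only a bounded amount is lost up to any fixed height `R`
(`IsRisingTrajectory.speedBarrier_le`). Run backwards from their end points, the trajectories
converge along a subsequence of `a → 0` to a profile that inherits the barrier
(`exists_isSpiralProfile`). Since `p > 2`, `r / (16 c)` behaves like `c ^ (2 / p - 1)` and blows up
as `c → 0`, which gives the height and steepness claims. -/

/-! ### The equation solved for `u''`, and a comparison principle. -/

/-- The second derivative `u''` prescribed by `u ^ p u'' + u ^ (p + 1) - u + c u' = 0`, where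
`v = u'`. -/
noncomputable def acceleration (p c u v : ℝ) : ℝ := u ^ (1 - p) - u - c * u ^ (-p) * v

lemma acceleration_eq_iff {p c u v w : ℝ} (hu : 0 < u) :
    w = acceleration p c u v ↔ u ^ p * w + u ^ (p + 1) - u + c * v = 0 := by
  have hup : 0 < u ^ p := Real.rpow_pos_of_pos hu p
  rw [acceleration, Real.rpow_sub hu, Real.rpow_add hu, Real.rpow_neg hu.le, Real.rpow_one,
    ← mul_right_inj' hup.ne']
  have : u ^ p * (u / u ^ p - u - c * (u ^ p)⁻¹ * v) = u - u ^ p * u - c * v := by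
    field_simp
  rw [this]
  constructor <;> intro h <;> linarith

/-- If `f` cannot increase where it is positive, then its positive values bound the earlier ones
from below. -/
lemma le_left_of_deriv_nonpos_of_pos {f f' : ℝ → ℝ} {s b : ℝ} (hsb : s ≤ b)
    (hc : ContinuousOn f (Icc s b)) (hd : ∀ x ∈ Ioo s b, HasDerivAt f (f' x) x)
    (h : ∀ x ∈ Ioo s b, 0 < f x → f' x ≤ 0) (hb : 0 < f b) : f b ≤ f s := by
  by_contra! hlt
  -- After the last time at which `f ≤ d`, the function exceeds `d > 0`, hence is antitone and
  -- cannot climb to `f b > d`.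
  obtain ⟨d, hd1, hd2⟩ := exists_between (max_lt hlt hb)
  have hS : IsCompact (Icc s b ∩ f ⁻¹' Iic d) :=
    isCompact_Icc.of_isClosed_subset (hc.preimage_isClosed_of_isClosed isClosed_Icc isClosed_Iic)
      inter_subset_left
  obtain ⟨x, ⟨hx, hxd⟩, hmax⟩ := hS.exists_isGreatest
    ⟨s, left_mem_Icc.2 hsb, ((le_max_left _ _).trans hd1.le : f s ≤ d)⟩
  have hgt : ∀ y ∈ Ioo x b, 0 < f y := fun y hy => by
    by_contra! hy0
    have : f y ≤ d := hy0.trans ((le_max_right _ _).trans hd1.le)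
    exact (hmax ⟨⟨hx.1.trans hy.1.le, hy.2.le⟩, this⟩).not_gt hy.1
  have hanti : AntitoneOn f (Icc x b) := by
    refine antitoneOn_of_hasDerivWithinAt_nonpos (f' := f') (convex_Icc _ _)
      (hc.mono (Icc_subset_Icc_left hx.1)) (fun y hy => ?_) (fun y hy => ?_)
    · rw [interior_Icc] at hy
      exact (hd y ⟨hx.1.trans_lt hy.1, hy.2⟩).hasDerivWithinAt
    · rw [interior_Icc] at hy
      exact h y ⟨hx.1.trans_lt hy.1, hy.2⟩ (hgt y hy)
  exact (hd2.trans_le (hanti (left_mem_Icc.2 hx.2) (right_mem_Icc.2 hx.2) hx.2)).not_ge hxd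

/-! ### A priori properties of profiles. -/

namespace IsSpiralProfile

variable {p c : ℝ} {U : ℝ → ℝ}

lemma contDiffOn_derivWithin (h : IsSpiralProfile p c U) :
    ContDiffOn ℝ ∞ (derivWithin U (Iic 0)) (Iic 0) :=
  h.smooth.derivWithin (uniqueDiffOn_Iic 0) (by simp)

lemma hasDerivAt (h : IsSpiralProfile p c U) {ξ : ℝ} (hξ : ξ < 0) :
    HasDerivAt U (derivWithin U (Iic 0) ξ) ξ :=
  ((h.smooth.differentiableOn (by simp)) ξ hξ.le).hasDerivWithinAt.hasDerivAt (Iic_mem_nhds hξ)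

lemma hasDerivAt_derivWithin (h : IsSpiralProfile p c U) {ξ : ℝ} (hξ : ξ < 0) :
    HasDerivAt (derivWithin U (Iic 0)) (acceleration p c (U ξ) (derivWithin U (Iic 0) ξ)) ξ := by
  rw [← (acceleration_eq_iff (h.pos ξ hξ.le)).2 (h.ode ξ hξ.le)]
  exact ((h.contDiffOn_derivWithin.differentiableOn (by simp)) ξ hξ.le).hasDerivWithinAt.hasDerivAt
    (Iic_mem_nhds hξ)

lemma strictMonoOn (h : IsSpiralProfile p c U) : StrictMonoOn U (Iic 0) := by
  refine strictMonoOn_of_hasDerivWithinAt_pos (f' := derivWithin U (Iic 0)) (convex_Iic 0)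
    h.smooth.continuousOn (fun x hx => ?_) (fun x hx => ?_)
  · rw [interior_Iic] at hx
    exact (h.hasDerivAt hx).hasDerivWithinAt
  · rw [interior_Iic] at hx
    exact h.deriv_pos x hx

/-- A trajectory above the line `v = u / c` would reach `u = 0` in finite backward time. -/
lemma derivWithin_le (h : IsSpiralProfile p c U) (hc : 0 < c) {ξ : ℝ} (hξ : ξ ≤ 0) :
    derivWithin U (Iic 0) ξ ≤ c⁻¹ * U ξ := by
  by_contra! hlt
  set V := derivWithin U (Iic 0)
  set β := V ξ - c⁻¹ * U ξ with hβ
  have hβ0 : 0 < β := sub_pos.2 hlt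
  -- Where `V > U / c`, damping outweighs the term `U ^ (1 - p)`, so the excess `V - U / c`
  -- decreases in time; backwards it stays at least `β`.
  have hback : ∀ s ≤ ξ, β ≤ V s := by
    intro s hs
    have hsub : Icc s ξ ⊆ Iic 0 := fun x hx => hx.2.trans hξ
    have := le_left_of_deriv_nonpos_of_pos (f := fun x => V x - c⁻¹ * U x)
      (f' := fun x => acceleration p c (U x) (V x) - c⁻¹ * V x) hs
      ((h.contDiffOn_derivWithin.continuousOn.mono hsub).sub
        (continuousOn_const.mul (h.smooth.continuousOn.mono hsub)))
      (fun x hx => (h.hasDerivAt_derivWithin (hx.2.trans_le hξ)).sub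
        ((h.hasDerivAt (hx.2.trans_le hξ)).const_mul _))
      (fun x hx hpos => ?_) hβ0
    · have := h.pos s (hs.trans hξ)
      have : 0 < c⁻¹ * U s := by positivity
      linarith
    · have hU := h.pos x (hx.2.trans_le hξ).le
      have hV := h.deriv_pos x (hx.2.trans_le hξ)
      have hVpos : 0 < c⁻¹ * V x := by positivity
      have hup : 0 < U x ^ (-p) := Real.rpow_pos_of_pos hU _
      have e1 : U x ^ (1 - p) = U x ^ (-p) * U x := by
        rw [sub_eq_neg_add, Real.rpow_add hU, Real.rpow_one]
      have e2 : acceleration p c (U x) (V x) = - (c * U x ^ (-p) * (V x - c⁻¹ * U x)) - U x := by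
        rw [acceleration, e1]
        field_simp
        ring
      have : 0 < c * U x ^ (-p) * (V x - c⁻¹ * U x) := by positivity
      rw [e2]
      linarith
  -- Far enough back for slope at least `β` to force `U s ≤ -β`.
  set s := ξ - U ξ / β - 1 with hs
  have hU := h.pos ξ hξ
  have hsξ : s < ξ := by
    have : 0 < U ξ / β := by positivity
    linarith
  have hmv := Convex.mul_sub_le_image_sub_of_le_deriv (D := Icc s ξ) (f := U) (convex_Icc s ξ)
    (h.smooth.continuousOn.mono fun x hx => hx.2.trans hξ)
    (fun x hx => by
      rw [interior_Icc] at hx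
      exact (h.hasDerivAt (hx.2.trans_le hξ)).differentiableAt.differentiableWithinAt)
    (C := β) (fun x hx => by
      rw [interior_Icc] at hx
      rw [(h.hasDerivAt (hx.2.trans_le hξ)).deriv]
      exact hback x hx.2.le) s (left_mem_Icc.2 hsξ.le) ξ (right_mem_Icc.2 hsξ.le) hsξ.le
  have e : β * (ξ - s) = U ξ + β := by
    rw [hs]; field_simp; ring
  have := h.pos s (hsξ.le.trans hξ)
  linarith

lemma surjOn (h : IsSpiralProfile p c U) : SurjOn U (Iic 0) (Ioc 0 (U 0)) := by
  intro u hu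
  obtain ⟨s, hs, hs0⟩ := ((h.tendsto_zero.eventually (gt_mem_nhds hu.1)).and
    (eventually_le_atBot 0)).exists
  obtain ⟨x, hx, hxu⟩ := intermediate_value_Icc hs0
    (h.smooth.continuousOn.mono (fun x hx => hx.2)) ⟨hs.le, hu.2⟩
  exact ⟨x, hx.2, hxu⟩

lemma mapsTo (h : IsSpiralProfile p c U) : MapsTo U (Iic 0) (Ioc 0 (U 0)) := fun x hx =>
  ⟨h.pos x hx, h.strictMonoOn.monotoneOn hx self_mem_Iic hx⟩

end IsSpiralProfile

/-! ### Energy as a function of height: uniqueness and monotonicity in the speed. -/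

/-- `e u` is the square of `U'` at the time `τ u` at which the increasing profile `U` takes the
value `u`. -/
structure IsPhaseCurve (p c : ℝ) (U e τ : ℝ → ℝ) : Prop where
  continuousOn_energy : ContinuousOn e (Ioc 0 (U 0))
  continuousOn_time : ContinuousOn τ (Ioc 0 (U 0))
  energy_top : e (U 0) = 0
  energy_pos : ∀ u ∈ Ioo 0 (U 0), 0 < e u
  energy_le : ∀ u ∈ Ioc 0 (U 0), e u ≤ (c⁻¹ * u) ^ 2
  hasDerivAt_energy : ∀ u ∈ Ioo 0 (U 0), HasDerivAt e (2 * acceleration p c u √(e u)) u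
  hasDerivAt_time : ∀ u ∈ Ioo 0 (U 0), HasDerivAt τ (√(e u))⁻¹ u
  apply_time : ∀ u ∈ Ioc 0 (U 0), U (τ u) = u
  time_apply : ∀ ξ ≤ 0, τ (U ξ) = ξ

lemma IsSpiralProfile.exists_isPhaseCurve {p c : ℝ} {U : ℝ → ℝ} (h : IsSpiralProfile p c U)
    (hc : 0 < c) : ∃ e τ, IsPhaseCurve p c U e τ := by
  set τ := Function.invFunOn U (Iic 0)
  set V := derivWithin U (Iic 0) with hV
  have hbij : BijOn U (Iic 0) (Ioc 0 (U 0)) := ⟨h.mapsTo, h.strictMonoOn.injOn, h.surjOn⟩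
  have hinv : InvOn τ U (Iic 0) (Ioc 0 (U 0)) := hbij.invOn_invFunOn
  have hτmaps : MapsTo τ (Ioc 0 (U 0)) (Iic 0) := h.surjOn.mapsTo_invFunOn
  have hτmono : StrictMonoOn τ (Ioc 0 (U 0)) := fun a ha b hb hab => by
    rw [← h.strictMonoOn.lt_iff_lt (hτmaps ha) (hτmaps hb), hinv.2 ha, hinv.2 hb]
    exact hab
  have hM : 0 < U 0 := h.pos 0 le_rfl
  have hτ0 : τ (U 0) = 0 := hinv.1 self_mem_Iic
  have hτneg : ∀ u ∈ Ioo 0 (U 0), τ u < 0 := fun u hu => by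
    rw [← hτ0]
    exact hτmono ⟨hu.1, hu.2.le⟩ ⟨hM, le_rfl⟩ hu.2
  have hτat : ∀ u ∈ Ioo 0 (U 0), ContinuousAt τ u := fun u hu =>
    hτmono.continuousAt_of_image_mem_nhds (Ioc_mem_nhds hu.1 hu.2)
      (by rw [(hinv.symm.bijOn hτmaps h.mapsTo).image_eq]; exact Iic_mem_nhds (hτneg u hu))
  have hτcont : ContinuousOn τ (Ioc 0 (U 0)) := fun u hu => by
    rcases hu.2.lt_or_eq with hlt | rfl
    · exact (hτat u ⟨hu.1, hlt⟩).continuousWithinAt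
    · refine (hτmono.continuousWithinAt_left_of_image_mem_nhdsWithin
        (Ioc_mem_nhdsLE hM) ?_).mono (fun x hx => hx.2)
      rw [(hinv.symm.bijOn hτmaps h.mapsTo).image_eq, hτ0]
      exact self_mem_nhdsWithin
  have hVnonneg : ∀ ξ ≤ 0, 0 ≤ V ξ := fun ξ hξ => by
    rcases hξ.lt_or_eq with hlt | rfl
    · exact (h.deriv_pos ξ hlt).le
    · exact h.deriv_zero.ge
  have hsqrt : ∀ u ∈ Ioc 0 (U 0), √(V (τ u) ^ 2) = V (τ u) := fun u hu =>
    Real.sqrt_sq (hVnonneg _ (hτmaps hu))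
  have hτder : ∀ u ∈ Ioo 0 (U 0), HasDerivAt τ (V (τ u))⁻¹ u := fun u hu =>
    HasDerivAt.of_local_left_inverse (hτat u hu) (h.hasDerivAt (hτneg u hu))
      (h.deriv_pos _ (hτneg u hu)).ne'
      (by filter_upwards [Ioo_mem_nhds hu.1 hu.2] with y hy using hinv.2 ⟨hy.1, hy.2.le⟩)
  refine ⟨fun u => V (τ u) ^ 2, τ, ?_, hτcont, ?_, ?_, ?_, ?_, ?_, fun u hu => hinv.2 hu,
    fun ξ hξ => hinv.1 hξ⟩
  · exact (h.contDiffOn_derivWithin.continuousOn.comp hτcont hτmaps).pow 2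
  · simp only [hτ0, hV, h.deriv_zero]; norm_num
  · exact fun u hu => pow_pos (h.deriv_pos _ (hτneg u hu)) 2
  · intro u hu
    have := h.derivWithin_le hc (hτmaps hu)
    rw [hinv.2 hu] at this
    exact pow_le_pow_left₀ (hVnonneg _ (hτmaps hu)) this 2
  · intro u hu
    have hu' : u ∈ Ioc 0 (U 0) := ⟨hu.1, hu.2.le⟩
    have hne := (h.deriv_pos _ (hτneg u hu)).ne'
    have h1 := ((h.hasDerivAt_derivWithin (hτneg u hu)).comp u (hτder u hu)).pow 2
    refine h1.congr_deriv ?_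
    simp only [hsqrt u hu', hinv.2 hu', Function.comp, Nat.cast_ofNat]
    rw [Nat.add_one_sub_one, pow_one, hV]
    field_simp
  · intro u hu
    simp only [hsqrt u ⟨hu.1, hu.2.le⟩]
    exact hτder u hu

namespace IsPhaseCurve

variable {p c c₁ c₂ : ℝ} {U₁ U₂ e₁ e₂ τ₁ τ₂ : ℝ → ℝ}

/-- The energy does not increase with the speed. -/
lemma energy_le_energy (h₁ : IsPhaseCurve p c₁ U₁ e₁ τ₁) (h₂ : IsPhaseCurve p c₂ U₂ e₂ τ₂)
    (hc₁ : 0 < c₁) (hc : c₁ ≤ c₂) {u : ℝ} (hu : 0 < u) (hu₁ : u ≤ U₁ 0) (hu₂ : u ≤ U₂ 0) :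
    e₂ u ≤ e₁ u := by
  by_contra! hlt
  have hback : ∀ s ∈ Ioc 0 u, e₂ u - e₁ u ≤ e₂ s - e₁ s := by
    intro s hs
    refine le_left_of_deriv_nonpos_of_pos (f := fun x => e₂ x - e₁ x)
      (f' := fun x => 2 * acceleration p c₂ x √(e₂ x) - 2 * acceleration p c₁ x √(e₁ x))
      hs.2 ((h₂.continuousOn_energy.mono fun x hx => ⟨hs.1.trans_le hx.1, hx.2.trans hu₂⟩).sub
        (h₁.continuousOn_energy.mono fun x hx => ⟨hs.1.trans_le hx.1, hx.2.trans hu₁⟩))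
      (fun x hx => (h₂.hasDerivAt_energy x ⟨hs.1.trans hx.1, hx.2.trans_le hu₂⟩).sub
        (h₁.hasDerivAt_energy x ⟨hs.1.trans hx.1, hx.2.trans_le hu₁⟩))
      (fun x hx hpos => ?_) (sub_pos.2 hlt)
    -- The terms free of `c` cancel in the derivative of `e₂ - e₁`; what remains is `-2 x ^ (-p) (c₂
    -- √e₂ - c₁ √e₁)`.
    have h12 : √(e₁ x) ≤ √(e₂ x) := Real.sqrt_le_sqrt (sub_pos.1 hpos).le
    have h3 : c₁ * √(e₁ x) ≤ c₂ * √(e₂ x) :=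
      mul_le_mul hc h12 (Real.sqrt_nonneg _) (hc₁.le.trans hc)
    have hxp : 0 < x ^ (-p) := Real.rpow_pos_of_pos (hs.1.trans hx.1) _
    have := mul_le_mul_of_nonneg_left h3 hxp.le
    simp only [acceleration]
    linarith
  have hpos : 0 < e₂ u - e₁ u := sub_pos.2 hlt
  have hlim : Tendsto (fun s : ℝ => (c₂⁻¹ * s) ^ 2) (𝓝[>] 0) (𝓝 0) := by
    have : Continuous fun s : ℝ => (c₂⁻¹ * s) ^ 2 := by fun_prop
    simpa using (this.tendsto 0).mono_left nhdsWithin_le_nhds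
  obtain ⟨s, hs1, hs2⟩ := ((hlim.eventually (gt_mem_nhds hpos)).and
    (Ioo_mem_nhdsGT hu)).exists
  have h2 := h₂.energy_le s ⟨hs2.1, hs2.2.le.trans hu₂⟩
  have h1 := h₁.energy_pos s ⟨hs2.1, hs2.2.trans_le hu₁⟩
  have := hback s ⟨hs2.1, hs2.2.le⟩
  linarith

/-- If `U₂` rose higher, `e₂` would still be positive at the height where the larger energy `e₁`
vanishes. -/
lemma top_le_top (h₁ : IsPhaseCurve p c₁ U₁ e₁ τ₁) (h₂ : IsPhaseCurve p c₂ U₂ e₂ τ₂)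
    (hc₁ : 0 < c₁) (hc : c₁ ≤ c₂) (hU₁ : 0 < U₁ 0) : U₂ 0 ≤ U₁ 0 := by
  by_contra! hlt
  have := h₁.energy_le_energy h₂ hc₁ hc hU₁ le_rfl hlt.le
  rw [h₁.energy_top] at this
  exact this.not_gt (h₂.energy_pos _ ⟨hU₁, hlt⟩)

lemma hasDerivAt_sqrt_energy {U e τ : ℝ → ℝ} (h : IsPhaseCurve p c U e τ) {u : ℝ}
    (hu : u ∈ Ioo 0 (U 0)) :
    HasDerivAt (fun x => √(e x)) ((u ^ (1 - p) - u) / √(e u) - c * u ^ (-p)) u := by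
  have hpos := Real.sqrt_pos.2 (h.energy_pos u hu)
  refine ((h.hasDerivAt_energy u hu).sqrt (h.energy_pos u hu).ne').congr_deriv ?_
  rw [acceleration]
  field_simp

/-- Passing to `√e` isolates the speed in the term `-c u ^ (-p)`. Above height `1` the force `u ^ (1
- p) - u` is negative, so the larger energy is slowed less by it. If the tops coincided, `√e₁ - √e₂`
would increase strictly from a nonnegative value at `1` to `0` at the top. -/
lemma top_lt_top (h₁ : IsPhaseCurve p c₁ U₁ e₁ τ₁) (h₂ : IsPhaseCurve p c₂ U₂ e₂ τ₂)
    (hp : 1 < p) (hc₁ : 0 < c₁) (hc : c₁ < c₂) (hU₁ : 1 < U₁ 0) : U₂ 0 < U₁ 0 := by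
  refine (h₁.top_le_top h₂ hc₁ hc.le (by linarith)).lt_of_ne fun hEq => ?_
  have hsub : Icc 1 (U₁ 0) ⊆ Ioc 0 (U₁ 0) := fun x hx => ⟨by linarith [hx.1], hx.2⟩
  have hmono : StrictMonoOn (fun x => √(e₁ x) - √(e₂ x)) (Icc 1 (U₁ 0)) := by
    refine strictMonoOn_of_hasDerivWithinAt_pos (convex_Icc _ _)
      (f' := fun u => ((u ^ (1 - p) - u) / √(e₁ u) - c₁ * u ^ (-p)) -
        ((u ^ (1 - p) - u) / √(e₂ u) - c₂ * u ^ (-p)))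
      (((h₁.continuousOn_energy.mono hsub).sqrt).sub
        ((h₂.continuousOn_energy.mono (hEq ▸ hsub)).sqrt)) (fun x hx => ?_) (fun x hx => ?_)
    · rw [interior_Icc] at hx
      have hx0 : 0 < x := by linarith [hx.1]
      exact ((h₁.hasDerivAt_sqrt_energy ⟨hx0, hx.2⟩).sub
        (h₂.hasDerivAt_sqrt_energy ⟨hx0, hEq ▸ hx.2⟩)).hasDerivWithinAt
    · rw [interior_Icc] at hx
      have hx0 : 0 < x := by linarith [hx.1]
      have he := Real.sqrt_le_sqrt
        (h₁.energy_le_energy h₂ hc₁ hc.le hx0 hx.2.le (hEq ▸ hx.2.le))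
      have he2 := Real.sqrt_pos.2 (h₂.energy_pos x ⟨hx0, hEq ▸ hx.2⟩)
      have hx1 : x ^ (1 - p) ≤ 1 :=
        Real.rpow_le_one_of_one_le_of_nonpos hx.1.le (by linarith)
      have hxp : 0 < x ^ (-p) := Real.rpow_pos_of_pos hx0 _
      have h1 : (x - x ^ (1 - p)) / √(e₁ x) ≤ (x - x ^ (1 - p)) / √(e₂ x) :=
        div_le_div_of_nonneg_left (by linarith [hx.1]) he2 he
      have h2 : c₁ * x ^ (-p) < c₂ * x ^ (-p) := mul_lt_mul_of_pos_right hc hxp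
      have n1 : (x ^ (1 - p) - x) / √(e₁ x) = -((x - x ^ (1 - p)) / √(e₁ x)) := by ring
      have n2 : (x ^ (1 - p) - x) / √(e₂ x) = -((x - x ^ (1 - p)) / √(e₂ x)) := by ring
      rw [n1, n2]
      linarith
  have := hmono (left_mem_Icc.2 hU₁.le) (right_mem_Icc.2 hU₁.le) hU₁
  have hle := Real.sqrt_le_sqrt
    (h₁.energy_le_energy h₂ hc₁ hc.le one_pos hU₁.le (hEq ▸ hU₁.le))
  have ht : e₂ (U₁ 0) = 0 := hEq ▸ h₂.energy_top
  simp only [h₁.energy_top, ht, sub_self] at this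
  linarith

/-- Comparison in both directions equates tops and energies. The inverse functions then have equal
derivatives `1 / √e` and the same value `0` at the top. -/
lemma eqOn (h₁ : IsPhaseCurve p c U₁ e₁ τ₁) (h₂ : IsPhaseCurve p c U₂ e₂ τ₂) (hc : 0 < c)
    (hmaps : MapsTo U₁ (Iic 0) (Ioc 0 (U₁ 0))) (hU₂ : 0 < U₂ 0) : EqOn U₁ U₂ (Iic 0) := by
  have hU₁ : 0 < U₁ 0 := (hmaps self_mem_Iic).1
  have hEq : U₁ 0 = U₂ 0 :=
    (h₂.top_le_top h₁ hc le_rfl hU₂).antisymm (h₁.top_le_top h₂ hc le_rfl hU₁)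
  have hτ : ∀ u ∈ Ioc 0 (U₁ 0), τ₁ u = τ₂ u := by
    intro u hu
    have hsub : Icc u (U₁ 0) ⊆ Ioc 0 (U₁ 0) := fun x hx => ⟨hu.1.trans_le hx.1, hx.2⟩
    have hconst : τ₁ (U₁ 0) - τ₂ (U₁ 0) = τ₁ u - τ₂ u := by
      rcases hu.2.lt_or_eq with hlt | rfl
      · obtain ⟨x, hx, hx'⟩ := exists_hasDerivAt_eq_slope (fun x => τ₁ x - τ₂ x)
          (fun x => (√(e₁ x))⁻¹ - (√(e₂ x))⁻¹) hlt
          ((h₁.continuousOn_time.mono hsub).sub (h₂.continuousOn_time.mono (hEq ▸ hsub)))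
          (fun x hx => (h₁.hasDerivAt_time x ⟨hu.1.trans hx.1, hx.2⟩).sub
            (h₂.hasDerivAt_time x ⟨hu.1.trans hx.1, hEq ▸ hx.2⟩))
        have he : e₁ x = e₂ x :=
          (h₂.energy_le_energy h₁ hc le_rfl (hu.1.trans hx.1) (hEq ▸ hx.2.le) hx.2.le).antisymm
            (h₁.energy_le_energy h₂ hc le_rfl (hu.1.trans hx.1) hx.2.le (hEq ▸ hx.2.le))
        rw [he, sub_self, eq_comm, div_eq_zero_iff] at hx'
        rcases hx' with hx' | hx'
        · linarith
        · linarith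
      · rfl
    have t1 := h₁.time_apply 0 le_rfl
    have t2 := h₂.time_apply 0 le_rfl
    rw [← hEq] at t2
    linarith
  intro ξ hξ
  have hmem := hmaps hξ
  have := h₂.apply_time (U₁ ξ) (hEq ▸ hmem)
  rw [← hτ _ hmem, h₁.time_apply ξ hξ] at this
  exact this.symm

end IsPhaseCurve

lemma IsSpiralProfile.eqOn {p c : ℝ} {U₁ U₂ : ℝ → ℝ} (h₁ : IsSpiralProfile p c U₁)
    (h₂ : IsSpiralProfile p c U₂) (hc : 0 < c) : EqOn U₁ U₂ (Iic 0) := by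
  obtain ⟨e₁, τ₁, H₁⟩ := h₁.exists_isPhaseCurve hc
  obtain ⟨e₂, τ₂, H₂⟩ := h₂.exists_isPhaseCurve hc
  exact H₁.eqOn H₂ hc h₁.mapsTo (h₂.pos 0 le_rfl)

lemma IsSpiralProfile.top_lt_top {p c₁ c₂ : ℝ} {U₁ U₂ : ℝ → ℝ} (h₁ : IsSpiralProfile p c₁ U₁)
    (h₂ : IsSpiralProfile p c₂ U₂) (hp : 1 < p) (hc₁ : 0 < c₁) (hc : c₁ < c₂) (hU₁ : 1 < U₁ 0) :
    U₂ 0 < U₁ 0 := by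
  obtain ⟨e₁, τ₁, H₁⟩ := h₁.exists_isPhaseCurve hc₁
  obtain ⟨e₂, τ₂, H₂⟩ := h₂.exists_isPhaseCurve (hc₁.trans hc)
  exact H₁.top_lt_top H₂ hp hc₁ hc hU₁

/-! ### Barriers for rising trajectories. -/

/-- A solution `(u, v = u')` on `[0, T]` of the profile equation which starts on the line
`v = u / c` at `u = a` and along which `u` does not decrease. -/
structure IsRisingTrajectory (p c a T : ℝ) (u v : ℝ → ℝ) : Prop where
  hasDerivWithinAt_fst : ∀ t ∈ Icc 0 T, HasDerivWithinAt u (v t) (Icc 0 T) t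
  hasDerivWithinAt_snd : ∀ t ∈ Icc 0 T,
    HasDerivWithinAt v (acceleration p c (u t) (v t)) (Icc 0 T) t
  fst_zero : u 0 = a
  snd_zero : v 0 = c⁻¹ * a
  snd_nonneg : ∀ t ∈ Icc 0 T, 0 ≤ v t

lemma rpow_one_sub_eq {u : ℝ} (hu : 0 < u) (p : ℝ) : u ^ (1 - p) = u ^ (-p) * u := by
  rw [sub_eq_neg_add, Real.rpow_add hu, Real.rpow_one]

lemma acceleration_le_neg_one {p c u v : ℝ} (hp : 1 < p) (hc : 0 < c) (hu : 2 ≤ u) (hv : 0 ≤ v) :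
    acceleration p c u v ≤ -1 := by
  have h1 : u ^ (1 - p) ≤ 1 :=
    Real.rpow_le_one_of_one_le_of_nonpos (by linarith) (by linarith)
  have h2 : 0 ≤ c * u ^ (-p) * v := by
    have : 0 < u ^ (-p) := Real.rpow_pos_of_pos (by linarith) _
    positivity
  rw [acceleration]
  linarith

/-- The lower bound for `u'` in terms of `u` that holds along rising trajectories with `u ≤ R`; the
parameter `r` is `(16 c ^ 2) ^ (1 / p)`. -/
noncomputable def speedBarrier (c r R u : ℝ) : ℝ :=
  min (u / (8 * c)) (r / (16 * c) - 2 * R * max (u - 1) 0)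

namespace IsRisingTrajectory

variable {p c a T : ℝ} {u v : ℝ → ℝ}

lemma continuousOn_fst (h : IsRisingTrajectory p c a T u v) : ContinuousOn u (Icc 0 T) :=
  fun t ht => (h.hasDerivWithinAt_fst t ht).continuousWithinAt

lemma continuousOn_snd (h : IsRisingTrajectory p c a T u v) : ContinuousOn v (Icc 0 T) :=
  fun t ht => (h.hasDerivWithinAt_snd t ht).continuousWithinAt

lemma hasDerivWithinAt_fst_Ici (h : IsRisingTrajectory p c a T u v) {t : ℝ} (ht : t ∈ Ico 0 T) :
    HasDerivWithinAt u (v t) (Ici t) t :=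
  (h.hasDerivWithinAt_fst t ⟨ht.1, ht.2.le⟩).mono_of_mem_nhdsWithin (Icc_mem_nhdsGE_of_mem ht)

lemma hasDerivWithinAt_snd_Ici (h : IsRisingTrajectory p c a T u v) {t : ℝ} (ht : t ∈ Ico 0 T) :
    HasDerivWithinAt v (acceleration p c (u t) (v t)) (Ici t) t :=
  (h.hasDerivWithinAt_snd t ⟨ht.1, ht.2.le⟩).mono_of_mem_nhdsWithin (Icc_mem_nhdsGE_of_mem ht)

lemma monotoneOn (h : IsRisingTrajectory p c a T u v) : MonotoneOn u (Icc 0 T) := by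
  refine monotoneOn_of_hasDerivWithinAt_nonneg (f' := v) (convex_Icc _ _) h.continuousOn_fst
    (fun t ht => ?_) (fun t ht => h.snd_nonneg t (interior_subset ht))
  exact (h.hasDerivWithinAt_fst t (interior_subset ht)).mono interior_subset

lemma le_fst (h : IsRisingTrajectory p c a T u v) {t : ℝ} (ht : t ∈ Icc 0 T) : a ≤ u t := by
  rw [← h.fst_zero]
  exact h.monotoneOn ⟨le_rfl, ht.1.trans ht.2⟩ ht ht.1

lemma fst_pos (h : IsRisingTrajectory p c a T u v) (ha : 0 < a) {t : ℝ} (ht : t ∈ Icc 0 T) :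
    0 < u t := ha.trans_le (h.le_fst ht)

/-- Values of `u` are attained in order. -/
lemma exists_fst_eq (h : IsRisingTrajectory p c a T u v) {t y : ℝ} (ht : t ∈ Icc 0 T)
    (hay : a ≤ y) (hy : y ≤ u t) : ∃ s ∈ Icc 0 t, u s = y :=
  intermediate_value_Icc ht.1 (h.continuousOn_fst.mono (Icc_subset_Icc_right ht.2))
    ⟨h.fst_zero.trans_le hay, hy⟩

/-- On the line `v = u / c` damping cancels `u ^ (1 - p)` exactly, leaving `v' = -u < 0 ≤ v / c`, so
the line is never crossed upwards. -/
lemma snd_le (h : IsRisingTrajectory p c a T u v) (ha : 0 < a) (hc : 0 < c) {t : ℝ}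
    (ht : t ∈ Icc 0 T) : v t ≤ c⁻¹ * u t := by
  refine image_le_of_deriv_right_lt_deriv_boundary' (f := v) (B := fun s => c⁻¹ * u s)
    (B' := fun s => c⁻¹ * v s) h.continuousOn_snd (fun s hs => h.hasDerivWithinAt_snd_Ici hs)
    (by simp [h.fst_zero, h.snd_zero]) (continuousOn_const.mul h.continuousOn_fst)
    (fun s hs => (h.hasDerivWithinAt_fst_Ici hs).const_mul _) (fun s hs heq => ?_) ht
  have hs' := Ico_subset_Icc_self hs
  have hu := h.fst_pos ha hs'
  have hv := h.snd_nonneg s hs'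
  have : acceleration p c (u s) (v s) = -u s := by
    rw [acceleration, rpow_one_sub_eq hu, heq]
    field_simp
    ring
  rw [this]
  have : 0 ≤ c⁻¹ * v s := by positivity
  linarith

/-- On the line `v = u / (8 c)` damping cancels only one eighth of `u ^ (1 - p)`, so `v' = u (7/8 u
^ (-p) - 1)`. As `u ^ (-p) ≥ 1 / (16 c ^ 2) ≥ 4` below height `r`, this exceeds the slope `v / (8 c)
= u / (64 c ^ 2)` of the line. -/
lemma le_snd_of_fst_le (h : IsRisingTrajectory p c a T u v) {r : ℝ} (ha : 0 < a) (hc : 0 < c)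
    (hc8 : c ≤ 1 / 8) (hp : 0 < p) (hrp : r ^ p = 16 * c ^ 2) {t : ℝ} (ht : t ∈ Icc 0 T)
    (hur : u t ≤ r) : u t / (8 * c) ≤ v t := by
  have hsub : Icc 0 t ⊆ Icc 0 T := Icc_subset_Icc_right ht.2
  refine image_le_of_deriv_right_lt_deriv_boundary' (f := fun s => u s / (8 * c)) (B := v)
    (f' := fun s => v s / (8 * c)) (B' := fun s => acceleration p c (u s) (v s))
    ((h.continuousOn_fst.mono hsub).div_const _)
    (fun s hs => (h.hasDerivWithinAt_fst_Ici ⟨hs.1, hs.2.trans_le ht.2⟩).div_const _) ?_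
    (h.continuousOn_snd.mono hsub)
    (fun s hs => h.hasDerivWithinAt_snd_Ici ⟨hs.1, hs.2.trans_le ht.2⟩) (fun s hs heq => ?_)
    (right_mem_Icc.2 ht.1)
  · rw [h.fst_zero, h.snd_zero, div_eq_inv_mul]
    gcongr
    linarith
  · have hs' : s ∈ Icc 0 T := hsub (Ico_subset_Icc_self hs)
    have hu := h.fst_pos ha hs'
    have hup : u s ^ p ≤ 16 * c ^ 2 := by
      rw [← hrp]
      exact Real.rpow_le_rpow hu.le ((h.monotoneOn hs' ht hs.2.le).trans hur) hp.le
    have hup0 : 0 < u s ^ p := Real.rpow_pos_of_pos hu _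
    have hinv : (16 * c ^ 2)⁻¹ ≤ u s ^ (-p) := by
      rw [Real.rpow_neg hu.le]
      exact inv_anti₀ hup0 hup
    have hacc : acceleration p c (u s) (v s) = u s * (7 / 8 * u s ^ (-p) - 1) := by
      rw [acceleration, rpow_one_sub_eq hu, ← heq]
      field_simp
      ring
    have hlhs : v s / (8 * c) = u s * (1 / 4 * (16 * c ^ 2)⁻¹) := by
      rw [← heq]
      field_simp
      norm_num
    rw [hacc, hlhs]
    refine mul_lt_mul_of_pos_left ?_ hu
    have h4 : 4 ≤ (16 * c ^ 2)⁻¹ := by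
      rw [le_inv_comm₀ (by norm_num) (by positivity)]
      nlinarith
    linarith

/-- The damping `-c u ^ (-p) u'` is the derivative of `c / (p - 1) * u ^ (1 - p)`, and the remaining
force is nonnegative for `u ≤ 1`. Hence the total loss after height `r` is at most `c r ^ (1 - p) /
(p - 1) = r / (16 c (p - 1))`. By `p > 2` this is at most half of the value `r / (8 c)` available at
height `r`. -/
lemma le_snd_of_le_fst_of_fst_le_one (h : IsRisingTrajectory p c a T u v) {r : ℝ} (ha : 0 < a)
    (hc : 0 < c) (hc8 : c ≤ 1 / 8) (hp : 2 < p) (hr : 0 < r) (hrp : r ^ p = 16 * c ^ 2)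
    (har : a ≤ r) {t : ℝ} (ht : t ∈ Icc 0 T) (hru : r ≤ u t) (hu1 : u t ≤ 1) :
    r / (16 * c) ≤ v t := by
  obtain ⟨s, hs, hsr⟩ := h.exists_fst_eq ht har hru
  have hs' : s ∈ Icc 0 T := ⟨hs.1, hs.2.trans ht.2⟩
  have hsub : Icc s t ⊆ Icc 0 T := Icc_subset_Icc hs.1 ht.2
  have hvs := h.le_snd_of_fst_le ha hc hc8 (by linarith) hrp hs' hsr.le
  have hmono : MonotoneOn (fun x => v x - c / (p - 1) * u x ^ (1 - p)) (Icc s t) := by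
    refine monotoneOn_of_hasDerivWithinAt_nonneg (convex_Icc _ _)
      (f' := fun x => acceleration p c (u x) (v x) -
        c / (p - 1) * (v x * (1 - p) * u x ^ (1 - p - 1)))
      ((h.continuousOn_snd.mono hsub).sub (continuousOn_const.mul
        ((h.continuousOn_fst.mono hsub).rpow_const
          fun x hx => Or.inl (h.fst_pos ha (hsub hx)).ne'))) (fun x hx => ?_) (fun x hx => ?_)
    · have hx' := hsub (interior_subset hx)
      exact (((h.hasDerivWithinAt_snd x hx').sub (((h.hasDerivWithinAt_fst x hx').rpow_const
        (Or.inl (h.fst_pos ha hx').ne')).const_mul _))).mono (interior_subset.trans hsub)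
    · have hx0 := interior_subset hx
      have hx' := hsub hx0
      have hu := h.fst_pos ha hx'
      have hux1 : u x ≤ 1 := (h.monotoneOn hx' ht hx0.2).trans hu1
      have h1 : 1 ≤ u x ^ (1 - p) :=
        Real.one_le_rpow_of_pos_of_le_one_of_nonpos hu hux1 (by linarith)
      have hp1 : p - 1 ≠ 0 := by linarith
      have e1 : (1 - p - 1 : ℝ) = -p := by ring
      have e2 : c / (p - 1) * (v x * (1 - p) * u x ^ (-p)) = -(c * u x ^ (-p) * v x) := by
        field_simp
        ring
      rw [acceleration, e1, e2]
      linarith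
  have hst := hmono (left_mem_Icc.2 hs.2) (right_mem_Icc.2 hs.2) hs.2
  simp only [hsr] at hst
  have hut : 0 < u t ^ (1 - p) := Real.rpow_pos_of_pos (h.fst_pos ha ht) _
  have hp1 : 0 < p - 1 := by linarith
  have hterm : 0 < c / (p - 1) * u t ^ (1 - p) := by positivity
  have hloss : c / (p - 1) * r ^ (1 - p) ≤ r / (16 * c) := by
    rw [rpow_one_sub_eq hr, Real.rpow_neg hr.le, hrp]
    have : c / (p - 1) * ((16 * c ^ 2)⁻¹ * r) = r / (16 * c) / (p - 1) := by
      field_simp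
    rw [this]
    exact div_le_self (by positivity) (by linarith)
  rw [hsr] at hvs
  have e3 : r / (8 * c) = r / (16 * c) + r / (16 * c) := by
    field_simp
    norm_num
  linarith

/-- At contact with the barrier the hypothesis on `r / (16 c)` gives `v > 1`. The forces are then at
least `-R - v`, which `2 R v` outweighs. -/
lemma le_snd_of_one_le_fst (h : IsRisingTrajectory p c a T u v) {r R : ℝ} (ha : 0 < a)
    (hc : 0 < c) (hc8 : c ≤ 1 / 8) (hp : 2 < p) (hr : 0 < r) (hr1 : r ≤ 1)
    (hrp : r ^ p = 16 * c ^ 2) (har : a ≤ r) (hR : 1 ≤ R) (hRr : 2 * R ^ 2 + 1 < r / (16 * c))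
    {t : ℝ} (ht : t ∈ Icc 0 T) (hu1 : 1 ≤ u t) (huR : u t ≤ R) :
    r / (16 * c) - 2 * R * (u t - 1) ≤ v t := by
  obtain ⟨s, hs, hs1⟩ := h.exists_fst_eq ht (har.trans hr1) hu1
  have hs' : s ∈ Icc 0 T := ⟨hs.1, hs.2.trans ht.2⟩
  have hsub : Icc s t ⊆ Icc 0 T := Icc_subset_Icc hs.1 ht.2
  have hvs := h.le_snd_of_le_fst_of_fst_le_one ha hc hc8 hp hr hrp har hs' (hs1 ▸ hr1) hs1.le
  have := image_le_of_deriv_right_lt_deriv_boundary' (f := fun _ => r / (16 * c))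
    (B := fun x => v x + 2 * R * (u x - 1)) (f' := fun _ => 0) (a := s) (b := t)
    (B' := fun x => acceleration p c (u x) (v x) + 2 * R * v x) continuousOn_const
    (fun x _ => hasDerivWithinAt_const _ _ _) (by simpa [hs1] using hvs)
    ((h.continuousOn_snd.mono hsub).add (continuousOn_const.mul
      ((h.continuousOn_fst.mono hsub).sub continuousOn_const)))
    (fun x hx => (h.hasDerivWithinAt_snd_Ici ⟨hs.1.trans hx.1, hx.2.trans_le ht.2⟩).add
      (((h.hasDerivWithinAt_fst_Ici ⟨hs.1.trans hx.1, hx.2.trans_le ht.2⟩).sub_const 1).const_mul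
        (2 * R))) (fun x hx heq => ?_) (right_mem_Icc.2 hs.2)
  · linarith
  · have hx' := hsub (Ico_subset_Icc_self hx)
    have hu := h.fst_pos ha hx'
    have huxR : u x ≤ R := (h.monotoneOn hx' ht hx.2.le).trans huR
    have hux1 : 1 ≤ u x := hs1 ▸ h.monotoneOn hs' hx' hx.1
    have hv1 : 1 < v x := by nlinarith
    have h1 : 0 < u x ^ (1 - p) := Real.rpow_pos_of_pos hu _
    have h2 : u x ^ (-p) ≤ 1 := Real.rpow_le_one_of_one_le_of_nonpos hux1 (by linarith)
    have h3 : 0 < u x ^ (-p) := Real.rpow_pos_of_pos hu _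
    have h4 : c * u x ^ (-p) * v x ≤ v x := by
      have : c * u x ^ (-p) ≤ 1 := mul_le_one₀ (by linarith) h3.le h2
      exact mul_le_of_le_one_left (by linarith) this
    rw [acceleration]
    nlinarith

lemma speedBarrier_le (h : IsRisingTrajectory p c a T u v) {r R : ℝ} (ha : 0 < a)
    (hc : 0 < c) (hc8 : c ≤ 1 / 8) (hp : 2 < p) (hr : 0 < r) (hr1 : r ≤ 1)
    (hrp : r ^ p = 16 * c ^ 2) (har : a ≤ r) (hR : 1 ≤ R) (hRr : 2 * R ^ 2 + 1 < r / (16 * c))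
    {t : ℝ} (ht : t ∈ Icc 0 T) (huR : u t ≤ R) : speedBarrier c r R (u t) ≤ v t := by
  rw [speedBarrier]
  rcases le_total (u t) r with hur | hur
  · exact (min_le_left _ _).trans (h.le_snd_of_fst_le ha hc hc8 (by linarith) hrp ht hur)
  refine (min_le_right _ _).trans ?_
  rcases le_total (u t) 1 with hu1 | hu1
  · rw [max_eq_right (by linarith), mul_zero, sub_zero]
    exact h.le_snd_of_le_fst_of_fst_le_one ha hc hc8 hp hr hrp har ht hur hu1
  · rw [max_eq_left (by linarith)]
    exact h.le_snd_of_one_le_fst ha hc hc8 hp hr hr1 hrp har hR hRr ht hu1 huR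

/-- Above height `2` one has `v' ≤ -1`, so `v ^ 2 / 2 + u` does not increase; at height `2` it is at
most `(2 / c) ^ 2 / 2 + 2`. -/
lemma fst_le (h : IsRisingTrajectory p c a T u v) (ha : 0 < a) (ha2 : a ≤ 2) (hc : 0 < c)
    (hp : 1 < p) {t : ℝ} (ht : t ∈ Icc 0 T) : u t ≤ 2 + 2 * c⁻¹ ^ 2 := by
  rcases le_total (u t) 2 with hu2 | hu2
  · have : 0 ≤ 2 * c⁻¹ ^ 2 := by positivity
    linarith
  obtain ⟨s, hs, hs2⟩ := h.exists_fst_eq ht ha2 hu2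
  have hs' : s ∈ Icc 0 T := ⟨hs.1, hs.2.trans ht.2⟩
  have hsub : Icc s t ⊆ Icc 0 T := Icc_subset_Icc hs.1 ht.2
  have hanti : AntitoneOn (fun x => v x ^ 2 / 2 + u x) (Icc s t) := by
    refine antitoneOn_of_hasDerivWithinAt_nonpos (convex_Icc _ _)
      (f' := fun x => v x * acceleration p c (u x) (v x) + v x)
      ((((h.continuousOn_snd.mono hsub).pow 2).div_const 2).add (h.continuousOn_fst.mono hsub))
      (fun x hx => ?_) (fun x hx => ?_)
    · have hx' := hsub (interior_subset hx)
      refine ((((h.hasDerivWithinAt_snd x hx').pow 2).div_const 2).add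
        (h.hasDerivWithinAt_fst x hx')).mono (interior_subset.trans hsub) |>.congr_deriv ?_
      simp only [Nat.cast_ofNat, Nat.add_one_sub_one, pow_one]
      ring
    · have hx0 := interior_subset hx
      have hx' := hsub hx0
      have hux : 2 ≤ u x := hs2 ▸ h.monotoneOn hs' hx' hx0.1
      have hv := h.snd_nonneg x hx'
      nlinarith [acceleration_le_neg_one hp hc hux hv]
  have := hanti (left_mem_Icc.2 hs.2) (right_mem_Icc.2 hs.2) hs.2
  simp only [hs2] at this
  have hvs := h.snd_le ha hc hs'
  rw [hs2] at hvs
  have := pow_le_pow_left₀ (h.snd_nonneg s hs') hvs 2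
  nlinarith [sq_nonneg (v t)]

end IsRisingTrajectory

/-! ### Construction of rising trajectories by truncating the vector field. -/

/-- A bounded Lipschitz vector field has solutions on every interval `[0, T]`. -/
lemma exists_hasDerivWithinAt_Icc_of_lipschitzWith {E : Type*} [NormedAddCommGroup E]
    [NormedSpace ℝ E] [CompleteSpace E] {F : E → E} {K : NNReal} {C T : ℝ} (hF : LipschitzWith K F)
    (hC : ∀ z, ‖F z‖ ≤ C) (hT : 0 ≤ T) (z₀ : E) :
    ∃ z : ℝ → E, z 0 = z₀ ∧ ∀ t ∈ Icc 0 T, HasDerivWithinAt z (F (z t)) (Icc 0 T) t := by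
  have hC0 : 0 ≤ C := (norm_nonneg _).trans (hC z₀)
  have hPL : IsPicardLindelof (fun _ => F) (⟨0, left_mem_Icc.2 hT⟩ : Icc 0 T) z₀
      (⟨C * T, by positivity⟩ : NNReal) 0 ⟨C, hC0⟩ K :=
    IsPicardLindelof.of_time_independent (fun z _ => hC z) hF.lipschitzOnWith
      (by change C * max (T - 0) (0 - 0) ≤ C * T - 0; simp [hT])
  exact hPL.exists_eq_forall_mem_Icc_hasDerivWithinAt₀

/-- The vector field of the profile equation, with both arguments truncated to a rectangle. -/
noncomputable def truncatedField (p c a B b : ℝ) (z : ℝ × ℝ) : ℝ × ℝ :=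
  (max 0 (min z.2 b), acceleration p c (max a (min z.1 B)) (max 0 (min z.2 b)))

lemma truncatedField_eq {p c a B b u v : ℝ} (hu : u ∈ Icc a B) (hv : v ∈ Icc 0 b) :
    truncatedField p c a B b (u, v) = (v, acceleration p c u v) := by
  simp [truncatedField, min_eq_left hu.2, min_eq_left hv.2, max_eq_right hu.1, max_eq_right hv.1]

lemma contDiffOn_acceleration (p c : ℝ) {n : WithTop ℕ∞} {s : Set ℝ} {u v : ℝ → ℝ}
    (hu : ContDiffOn ℝ n u s) (hv : ContDiffOn ℝ n v s) (hpos : ∀ x ∈ s, 0 < u x) :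
    ContDiffOn ℝ n (fun x => acceleration p c (u x) (v x)) s := by
  unfold acceleration
  exact ((hu.rpow_const_of_ne fun x hx => (hpos x hx).ne').sub hu).sub
    ((contDiffOn_const.mul (hu.rpow_const_of_ne fun x hx => (hpos x hx).ne')).mul hv)

lemma exists_lipschitzWith_truncatedField (p c : ℝ) {a B b : ℝ} (ha : 0 < a) (haB : a ≤ B)
    (hb : 0 ≤ b) : ∃ K C, LipschitzWith K (truncatedField p c a B b) ∧
      ∀ z, ‖truncatedField p c a B b z‖ ≤ C := by
  set S : Set (ℝ × ℝ) := Icc a B ×ˢ Icc 0 b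
  set G : ℝ × ℝ → ℝ × ℝ := fun z => (z.2, acceleration p c z.1 z.2) with hG
  set π : ℝ × ℝ → ℝ × ℝ := fun z => (max a (min z.1 B), max 0 (min z.2 b)) with hπ
  have hS : IsCompact S := isCompact_Icc.prod isCompact_Icc
  have hconv : Convex ℝ S := (convex_Icc a B).prod (convex_Icc 0 b)
  have hsmooth : ContDiffOn ℝ 1 G S := by
    have hpos : ∀ z ∈ S, z.1 ≠ 0 := fun z hz => (ha.trans_le hz.1.1).ne'
    have h1 : ContDiffOn ℝ 1 (fun z : ℝ × ℝ => z.1) S := contDiffOn_fst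
    have h2 : ContDiffOn ℝ 1 (fun z : ℝ × ℝ => z.2) S := contDiffOn_snd
    unfold G acceleration
    exact h2.prodMk (((h1.rpow_const_of_ne hpos).sub h1).sub
      ((contDiffOn_const.mul (h1.rpow_const_of_ne hpos)).mul h2))
  obtain ⟨K, hK⟩ := LocallyLipschitzOn.exists_lipschitzOnWith_of_compact hS
    (fun z hz => (hsmooth z hz).exists_lipschitzOnWith hconv)
  obtain ⟨C, hC⟩ := hS.exists_bound_of_continuousOn hsmooth.continuousOn
  have hπS : ∀ z, π z ∈ S := fun z =>
    ⟨⟨le_max_left _ _, max_le haB (min_le_right _ _)⟩,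
      ⟨le_max_left _ _, max_le hb (min_le_right _ _)⟩⟩
  have hπL : LipschitzWith 1 π := by
    have h1 : LipschitzWith 1 (fun z : ℝ × ℝ => max a (min z.1 B)) :=
      (LipschitzWith.prod_fst.min_const B).const_max a
    have h2 : LipschitzWith 1 (fun z : ℝ × ℝ => max 0 (min z.2 b)) :=
      (LipschitzWith.prod_snd.min_const b).const_max 0
    simpa using h1.prodMk h2
  refine ⟨K * 1, C, ?_, fun z => hC (π z) (hπS z)⟩
  have := hK.comp (hπL.lipschitzOnWith (s := univ)) (fun z _ => hπS z)
  exact lipschitzOnWith_univ.1 this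

/-- The truncation is inactive while `v ≥ 0`: then `v' ≤ a ^ (1 - p)` gives `v ≤ b`, and `0 ≤ v ≤ b`
keeps `u` between `a` and `a + b T`. -/
lemma isRisingTrajectory_of_truncatedField {p c a b T S : ℝ} {u v : ℝ → ℝ} (hp : 1 < p)
    (hc : 0 < c) (ha : 0 < a) (hT : 0 ≤ T) (hST : S ≤ T) (hb : b = c⁻¹ * a + a ^ (1 - p) * T)
    (hu : ∀ t ∈ Icc 0 T, HasDerivWithinAt u
      (truncatedField p c a (a + b * T) b (u t, v t)).1 (Icc 0 T) t)
    (hv : ∀ t ∈ Icc 0 T, HasDerivWithinAt v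
      (truncatedField p c a (a + b * T) b (u t, v t)).2 (Icc 0 T) t)
    (hu0 : u 0 = a) (hv0 : v 0 = c⁻¹ * a) (hv_nonneg : ∀ t ∈ Icc 0 S, 0 ≤ v t) :
    IsRisingTrajectory p c a S u v := by
  have hsub : Icc 0 S ⊆ Icc 0 T := Icc_subset_Icc_right hST
  have hpow : 0 < a ^ (1 - p) := Real.rpow_pos_of_pos ha _
  have hb0 : 0 ≤ b := by rw [hb]; positivity
  have hIci : ∀ {f : ℝ → ℝ} {f' t : ℝ}, t ∈ Ico 0 S → HasDerivWithinAt f f' (Icc 0 T) t →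
      HasDerivWithinAt f f' (Ici t) t := fun ht h =>
    h.mono_of_mem_nhdsWithin (Icc_mem_nhdsGE_of_mem ⟨ht.1, ht.2.trans_le hST⟩)
  have hucont : ContinuousOn u (Icc 0 S) := fun t ht =>
    (hu t (hsub ht)).continuousWithinAt.mono hsub
  have hvcont : ContinuousOn v (Icc 0 S) := fun t ht =>
    (hv t (hsub ht)).continuousWithinAt.mono hsub
  have hvb : ∀ t ∈ Icc 0 S, v t ∈ Icc 0 b := by
    refine fun t ht => ⟨hv_nonneg t ht, ?_⟩
    have key : v t ≤ c⁻¹ * a + a ^ (1 - p) * t := by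
      refine image_le_of_deriv_right_le_deriv_boundary (f := v)
        (B := fun t => c⁻¹ * a + a ^ (1 - p) * t) (B' := fun _ => a ^ (1 - p)) hvcont
        (fun s hs => hIci hs (hv s (hsub (Ico_subset_Icc_self hs)))) (by simp [hv0]) (by fun_prop)
        (fun s hs => ?_) (fun s hs => ?_) ht
      · exact (((hasDerivAt_id s).const_mul (a ^ (1 - p))).const_add (c⁻¹ * a)).hasDerivWithinAt
          |>.congr_deriv (mul_one _)
      · set u' := max a (min (u s) (a + b * T))
        set v' := max 0 (min (v s) b)
        have hu' : a ≤ u' := le_max_left _ _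
        have hv' : 0 ≤ v' := le_max_left _ _
        have h1 : u' ^ (1 - p) ≤ a ^ (1 - p) :=
          Real.rpow_le_rpow_of_nonpos ha hu' (by linarith)
        have h2 : 0 < u' ^ (-p) := Real.rpow_pos_of_pos (by linarith) _
        have h3 : 0 ≤ c * u' ^ (-p) * v' := by positivity
        change acceleration p c u' v' ≤ _
        rw [acceleration]
        linarith
    have : a ^ (1 - p) * t ≤ a ^ (1 - p) * T := by
      gcongr
      exact (hsub ht).2
    linarith
  have hfst : ∀ t ∈ Icc 0 S, (truncatedField p c a (a + b * T) b (u t, v t)).1 = v t :=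
    fun t ht => by simp [truncatedField, min_eq_left (hvb t ht).2, (hvb t ht).1]
  have hua : ∀ t ∈ Icc 0 S, u t ∈ Icc a (a + b * T) := by
    refine fun t ht => ⟨?_, ?_⟩
    · refine image_le_of_deriv_right_le_deriv_boundary (f := fun _ => a) (f' := fun _ => 0)
        (B := u) continuousOn_const (fun s hs => hasDerivWithinAt_const _ _ _) hu0.ge hucont
        (fun s hs => hIci hs (hu s (hsub (Ico_subset_Icc_self hs)))) (fun s hs => ?_) ht
      rw [hfst s (Ico_subset_Icc_self hs)]
      exact hv_nonneg s (Ico_subset_Icc_self hs)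
    · have key : u t ≤ a + b * t := by
        refine image_le_of_deriv_right_le_deriv_boundary (f := u)
          (B := fun t => a + b * t) (B' := fun _ => b) hucont
          (fun s hs => hIci hs (hu s (hsub (Ico_subset_Icc_self hs)))) (by simp [hu0])
          (by fun_prop) (fun s hs => ?_) (fun s hs => ?_) ht
        · exact (((hasDerivAt_id s).const_mul b).const_add a).hasDerivWithinAt
            |>.congr_deriv (mul_one _)
        · rw [hfst s (Ico_subset_Icc_self hs)]
          exact (hvb s (Ico_subset_Icc_self hs)).2
      have : b * t ≤ b * T := by
        gcongr
        exact (hsub ht).2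
      linarith
  refine ⟨fun t ht => ?_, fun t ht => ?_, hu0, hv0, hv_nonneg⟩
  · have := (hu t (hsub ht)).mono hsub
    rwa [truncatedField_eq (hua t ht) (hvb t ht)] at this
  · have := (hv t (hsub ht)).mono hsub
    rwa [truncatedField_eq (hua t ht) (hvb t ht)] at this

/-- Along a rising trajectory `u'` vanishes before an explicit time. -/
lemma IsRisingTrajectory.snd_nonpos_of_eq {p c r a σ T : ℝ} {u v : ℝ → ℝ} (hp : 2 < p) (hc : 0 < c)
    (hc8 : c ≤ 1 / 8) (hr : 0 < r) (hr1 : r ≤ 1) (hrp : r ^ p = 16 * c ^ 2)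
    (hrc : 9 < r / (16 * c)) (ha : 0 < a) (har : a ≤ r) (hσ : 0 < σ) (hσ1 : σ ≤ 1)
    (hσa : σ ≤ a / (8 * c)) (hT : T = 2 / σ + c⁻¹ * (2 + 2 * c⁻¹ ^ 2) + 1)
    (h : IsRisingTrajectory p c a T u v) : v T ≤ 0 := by
  set t₁ := 2 / σ with ht₁
  have hB : 0 < c⁻¹ * (2 + 2 * c⁻¹ ^ 2) := by positivity
  have ht₁0 : 0 < t₁ := by positivity
  have ht₁T : t₁ ≤ T := by linarith
  have hmem : t₁ ∈ Icc 0 T := ⟨ht₁0.le, ht₁T⟩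
  have hsub₁ : Icc 0 t₁ ⊆ Icc 0 T := Icc_subset_Icc_right ht₁T
  have hsub₂ : Icc t₁ T ⊆ Icc 0 T := Icc_subset_Icc_left ht₁0.le
  -- Below height `2` the barrier with `R = 2` gives speed at least `σ`, so `u` reaches `2` by time
  -- `2 / σ`. From then on `v' ≤ -1` exhausts `v ≤ u / c` within the remaining time.
  have hu2 : 2 ≤ u t₁ := by
    by_contra! hlt
    have key : a + σ * t₁ ≤ u t₁ := by
      refine image_le_of_deriv_right_le_deriv_boundary (f := fun t => a + σ * t)
        (f' := fun _ => σ) (B := u) (by fun_prop) (fun s hs => ?_) (by simp [h.fst_zero])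
        (h.continuousOn_fst.mono hsub₁)
        (fun s hs => h.hasDerivWithinAt_fst_Ici ⟨hs.1, hs.2.trans_le ht₁T⟩) (fun s hs => ?_)
        (right_mem_Icc.2 ht₁0.le)
      · exact (((hasDerivAt_id s).const_mul σ).const_add a).hasDerivWithinAt
          |>.congr_deriv (mul_one _)
      · have hs' := hsub₁ (Ico_subset_Icc_self hs)
        have hus : u s ≤ 2 := (h.monotoneOn hs' hmem hs.2.le).trans hlt.le
        refine le_trans ?_ (h.speedBarrier_le ha hc hc8 hp hr hr1 hrp har one_le_two
          (by linarith) hs' hus)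
        rw [speedBarrier, le_min_iff]
        constructor
        · refine hσa.trans ?_
          gcongr
          exact h.le_fst hs'
        · have : max (u s - 1) 0 ≤ 1 := max_le (by linarith) zero_le_one
          linarith
    have : σ * t₁ = 2 := by rw [ht₁]; field_simp
    linarith
  have key : v T ≤ v t₁ - (T - t₁) := by
    refine image_le_of_deriv_right_le_deriv_boundary (f := v) (B := fun t => v t₁ - (t - t₁))
      (B' := fun _ => -1) (h.continuousOn_snd.mono hsub₂)
      (fun s hs => h.hasDerivWithinAt_snd_Ici ⟨ht₁0.le.trans hs.1, hs.2⟩) (by simp)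
      (by fun_prop) (fun s hs => ?_) (fun s hs => ?_) (right_mem_Icc.2 ht₁T)
    · exact (((hasDerivAt_id s).sub_const t₁).const_sub (v t₁)).hasDerivWithinAt
    · have hs' := hsub₂ (Ico_subset_Icc_self hs)
      exact acceleration_le_neg_one (by linarith) hc (hu2.trans (h.monotoneOn hmem hs' hs.1))
        (h.snd_nonneg s hs')
  have h1 := h.snd_le ha hc hmem
  have h2 : c⁻¹ * u t₁ ≤ c⁻¹ * (2 + 2 * c⁻¹ ^ 2) := by
    gcongr
    exact h.fst_le ha (by linarith) hc (by linarith) hmem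
  linarith

lemma exists_isRisingTrajectory {p c r a : ℝ} (hp : 2 < p) (hc : 0 < c) (hc8 : c ≤ 1 / 8)
    (hr : 0 < r) (hr1 : r ≤ 1) (hrp : r ^ p = 16 * c ^ 2) (hrc : 9 < r / (16 * c)) (ha : 0 < a)
    (har : a ≤ r) : ∃ T u v, 0 ≤ T ∧ IsRisingTrajectory p c a T u v ∧ v T = 0 := by
  set σ := min (a / (8 * c)) 1
  have hσ : 0 < σ := lt_min (by positivity) one_pos
  set T := 2 / σ + c⁻¹ * (2 + 2 * c⁻¹ ^ 2) + 1 with hT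
  have hT0 : 0 ≤ T := by positivity
  have hpow : 0 < a ^ (1 - p) := Real.rpow_pos_of_pos ha _
  set b := c⁻¹ * a + a ^ (1 - p) * T with hb
  have hb0 : 0 ≤ b := by positivity
  obtain ⟨K, C, hK, hC⟩ := exists_lipschitzWith_truncatedField p c ha
    (le_add_of_nonneg_right (mul_nonneg hb0 hT0)) hb0
  obtain ⟨z, hz0, hz⟩ := exists_hasDerivWithinAt_Icc_of_lipschitzWith hK hC hT0 (a, c⁻¹ * a)
  have hu : ∀ t ∈ Icc 0 T, HasDerivWithinAt (fun t => (z t).1)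
      (truncatedField p c a (a + b * T) b (z t)).1 (Icc 0 T) t := fun t ht =>
    (ContinuousLinearMap.fst ℝ ℝ ℝ).hasFDerivAt.comp_hasDerivWithinAt t (hz t ht)
  have hv : ∀ t ∈ Icc 0 T, HasDerivWithinAt (fun t => (z t).2)
      (truncatedField p c a (a + b * T) b (z t)).2 (Icc 0 T) t := fun t ht =>
    (ContinuousLinearMap.snd ℝ ℝ ℝ).hasFDerivAt.comp_hasDerivWithinAt t (hz t ht)
  have hrise : ∀ S ≤ T, (∀ t ∈ Icc 0 S, 0 ≤ (z t).2) →
      IsRisingTrajectory p c a S (fun t => (z t).1) (fun t => (z t).2) := fun S hS hnn =>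
    isRisingTrajectory_of_truncatedField (by linarith) hc ha hT0 hS hb hu hv (by simp [hz0])
      (by simp [hz0]) hnn
  have hcont : ContinuousOn (fun t => (z t).2) (Icc 0 T) := fun t ht =>
    (hv t ht).continuousWithinAt
  -- If `v` stayed positive, the trajectory would rise on all of `[0, T]`, against the explicit
  -- bound. The trajectory is cut at the first time with `v ≤ 0`.
  have hne : (Icc 0 T ∩ (fun t => (z t).2) ⁻¹' Iic 0).Nonempty := by
    by_contra hemp
    have hpos : ∀ t ∈ Icc 0 T, 0 < (z t).2 := fun t ht => by
      by_contra! hle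
      exact hemp ⟨t, ht, hle⟩
    exact (hpos T ⟨hT0, le_rfl⟩).not_ge ((hrise T le_rfl fun t ht => (hpos t ht).le).snd_nonpos_of_eq hp hc
      hc8 hr hr1 hrp hrc ha har hσ (min_le_right _ _) (min_le_left _ _) hT)
  have hS : IsCompact (Icc 0 T ∩ (fun t => (z t).2) ⁻¹' Iic 0) :=
    isCompact_Icc.of_isClosed_subset
      (hcont.preimage_isClosed_of_isClosed isClosed_Icc isClosed_Iic) inter_subset_left
  obtain ⟨S, ⟨hST, hS0⟩, hmin⟩ := hS.exists_isLeast hne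
  have hbefore : ∀ t ∈ Ico 0 S, 0 < (z t).2 := fun t ht => by
    by_contra! hle
    exact (hmin ⟨⟨ht.1, ht.2.le.trans hST.2⟩, hle⟩).not_gt ht.2
  have hSzero : (z S).2 = 0 := by
    refine le_antisymm hS0 ?_
    by_contra! hneg
    have hz00 : 0 ≤ (z 0).2 := by
      rw [hz0]
      positivity
    obtain ⟨t, ht, ht0⟩ := intermediate_value_Icc' hST.1
      (hcont.mono (Icc_subset_Icc_right hST.2)) ⟨hneg.le, hz00⟩
    rcases ht.2.lt_or_eq with hlt | rfl
    · exact (hbefore t ⟨ht.1, hlt⟩).ne' ht0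
    · exact hneg.ne ht0
  refine ⟨S, _, _, hST.1, hrise S hST.2 fun t ht => ?_, hSzero⟩
  rcases ht.2.lt_or_eq with hlt | rfl
  · exact (hbefore t ⟨ht.1, hlt⟩).le
  · exact hSzero.ge

/-! ### When a backward solution is a profile. -/

lemma contDiffOn_of_hasDerivWithinAt_acceleration {p c : ℝ} {U V : ℝ → ℝ}
    (hU : ∀ ξ ≤ 0, HasDerivWithinAt U (V ξ) (Iic 0) ξ)
    (hV : ∀ ξ ≤ 0, HasDerivWithinAt V (acceleration p c (U ξ) (V ξ)) (Iic 0) ξ)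
    (hpos : ∀ ξ ≤ 0, 0 < U ξ) : ContDiffOn ℝ ∞ U (Iic 0) := by
  have hs := uniqueDiffOn_Iic (0 : ℝ)
  have key : ∀ n : ℕ, ContDiffOn ℝ n U (Iic 0) ∧ ContDiffOn ℝ n V (Iic 0) := by
    intro n
    induction n with
    | zero =>
      simp only [Nat.cast_zero, contDiffOn_zero]
      exact ⟨fun ξ hξ => (hU ξ hξ).continuousWithinAt, fun ξ hξ => (hV ξ hξ).continuousWithinAt⟩
    | succ n ih =>
      rw [Nat.cast_succ, contDiffOn_succ_iff_derivWithin hs, contDiffOn_succ_iff_derivWithin hs]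
      refine ⟨⟨fun ξ hξ => (hU ξ hξ).differentiableWithinAt, by simp, ?_⟩,
        ⟨fun ξ hξ => (hV ξ hξ).differentiableWithinAt, by simp, ?_⟩⟩
      · exact ih.2.congr fun ξ hξ => (hU ξ hξ).derivWithin (hs ξ hξ)
      · exact (contDiffOn_acceleration p c ih.1 ih.2 hpos).congr
          fun ξ hξ => (hV ξ hξ).derivWithin (hs ξ hξ)
  exact contDiffOn_infty.2 fun n => (key n).1

lemma speedBarrier_pos {c r R u : ℝ} (hc : 0 < c) (hR : 1 ≤ R)
    (hRr : 2 * R ^ 2 + 1 < r / (16 * c)) (hu : 0 < u) (huR : u ≤ R) :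
    0 < speedBarrier c r R u := by
  refine lt_min (by positivity) ?_
  have : max (u - 1) 0 ≤ R := max_le (by linarith) (by linarith)
  nlinarith

/-- The barrier excludes a positive limit at `-∞` and zeros of `V` below height `R`. At height `R ≥
2` or above, an interior zero of `V ≥ 0` would be a minimum, incompatible with `V' ≤ -1`. -/
lemma isSpiralProfile_of_speedBarrier_le {p c r R : ℝ} {U V : ℝ → ℝ} (hp : 1 < p) (hc : 0 < c)
    (hR : 2 ≤ R) (hRr : 2 * R ^ 2 + 1 < r / (16 * c))
    (hU : ∀ ξ ≤ 0, HasDerivWithinAt U (V ξ) (Iic 0) ξ)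
    (hV : ∀ ξ ≤ 0, HasDerivWithinAt V (acceleration p c (U ξ) (V ξ)) (Iic 0) ξ)
    (hpos : ∀ ξ ≤ 0, 0 < U ξ) (hVnn : ∀ ξ ≤ 0, 0 ≤ V ξ) (hVle : ∀ ξ ≤ 0, V ξ ≤ c⁻¹ * U ξ)
    (hV0 : V 0 = 0) (hbar : ∀ ξ ≤ 0, U ξ < R → speedBarrier c r R (U ξ) ≤ V ξ) :
    IsSpiralProfile p c U := by
  have hs := uniqueDiffOn_Iic (0 : ℝ)
  have hdU : ∀ ξ ≤ 0, derivWithin U (Iic 0) ξ = V ξ := fun ξ hξ =>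
    (hU ξ hξ).derivWithin (hs ξ hξ)
  have hUat : ∀ ξ < 0, HasDerivAt U (V ξ) ξ := fun ξ hξ =>
    (hU ξ hξ.le).hasDerivAt (Iic_mem_nhds hξ)
  have hVat : ∀ ξ < 0, HasDerivAt V (acceleration p c (U ξ) (V ξ)) ξ := fun ξ hξ =>
    (hV ξ hξ.le).hasDerivAt (Iic_mem_nhds hξ)
  have hUcont : ContinuousOn U (Iic 0) := fun ξ hξ => (hU ξ hξ).continuousWithinAt
  have hVcont : ContinuousOn V (Iic 0) := fun ξ hξ => (hV ξ hξ).continuousWithinAt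
  have hmono : MonotoneOn U (Iic 0) := by
    refine monotoneOn_of_hasDerivWithinAt_nonneg (f' := V) (convex_Iic _) hUcont
      (fun ξ hξ => (hU ξ (interior_subset hξ : ξ ∈ Iic 0)).mono interior_subset)
      (fun ξ hξ => hVnn ξ (interior_subset hξ : ξ ∈ Iic 0))
  have hsmall : ∀ ε > 0, ∃ ξ ≤ 0, U ξ < ε := by
    intro ε hε
    by_contra! hge
    -- Otherwise `V' ≤ -1` throughout, and `V` would grow backwards beyond its bound `U 0 / c`.
    have hlt2 : ∃ ξ ≤ 0, U ξ < 2 := by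
      by_contra! hge2
      have hU0 := hpos 0 le_rfl
      set s := -(c⁻¹ * U 0) - 1 with hs_def
      have hs0 : s < 0 := by
        have : 0 < c⁻¹ * U 0 := by positivity
        linarith
      have hmv := Convex.image_sub_le_mul_sub_of_deriv_le (D := Iic 0) (f := V) (convex_Iic 0)
        hVcont (fun x hx => by
          rw [interior_Iic] at hx
          exact (hVat x hx).differentiableAt.differentiableWithinAt)
        (C := -1) (fun x hx => by
          rw [interior_Iic] at hx
          rw [(hVat x hx).deriv]
          exact acceleration_le_neg_one hp hc (hge2 x hx.le) (hVnn x hx.le))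
        s hs0.le 0 self_mem_Iic hs0.le
      have h1 := hVle s hs0.le
      have h2 : c⁻¹ * U s ≤ c⁻¹ * U 0 := by
        gcongr
        exact hmono hs0.le self_mem_Iic hs0.le
      rw [hV0] at hmv
      linarith
    obtain ⟨ξ₀, hξ₀, hU2⟩ := hlt2
    -- The minimum of the barrier over heights between `ε` and `2`: at this speed `U` would reach
    -- `0` in finite backward time.
    set σ := min (ε / (8 * c)) (r / (16 * c) - 2 * R)
    have hσ : 0 < σ := lt_min (by positivity) (by nlinarith)
    have hle : ∀ ξ ≤ ξ₀, σ ≤ V ξ := by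
      intro ξ hξ
      have hUξ : U ξ < 2 := (hmono (hξ.trans hξ₀) hξ₀ hξ).trans_lt hU2
      refine le_trans ?_ (hbar ξ (hξ.trans hξ₀) (by linarith))
      refine min_le_min ?_ ?_
      · have := hge ξ (hξ.trans hξ₀)
        gcongr
      · have : max (U ξ - 1) 0 ≤ 1 := max_le (by linarith) zero_le_one
        nlinarith
    have hU0 := hpos ξ₀ hξ₀
    set s := ξ₀ - U ξ₀ / σ with hs_def
    have hs0 : s < ξ₀ := by
      have : 0 < U ξ₀ / σ := by positivity
      linarith
    have hmv := Convex.mul_sub_le_image_sub_of_le_deriv (D := Iic ξ₀) (f := U) (convex_Iic ξ₀)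
      (hUcont.mono (Iic_subset_Iic.2 hξ₀)) (fun x hx => by
        rw [interior_Iic] at hx
        exact (hUat x (lt_of_lt_of_le hx hξ₀)).differentiableAt.differentiableWithinAt)
      (C := σ) (fun x hx => by
        rw [interior_Iic] at hx
        rw [(hUat x (lt_of_lt_of_le hx hξ₀)).deriv]
        exact hle x hx.le)
      s hs0.le ξ₀ self_mem_Iic hs0.le
    have e : σ * (ξ₀ - s) = U ξ₀ := by
      rw [hs_def]
      field_simp
      ring
    have := hpos s (hs0.le.trans hξ₀)
    linarith
  refine ⟨contDiffOn_of_hasDerivWithinAt_acceleration hU hV hpos, hpos, fun ξ hξ => ?_, ?_,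
    fun ξ hξ => ?_, by rw [hdU 0 le_rfl, hV0]⟩
  · rw [hdU ξ hξ, derivWithin_congr (s := Iic 0) (fun x hx => hdU x hx) (hdU ξ hξ)]
    exact (acceleration_eq_iff (hpos ξ hξ)).1 ((hV ξ hξ).derivWithin (hs ξ hξ))
  · rw [Metric.tendsto_nhds]
    intro ε hε
    obtain ⟨ξ₀, hξ₀, hlt⟩ := hsmall ε hε
    filter_upwards [eventually_le_atBot ξ₀] with ξ hξ
    rw [Real.dist_0_eq_abs, abs_of_pos (hpos ξ (hξ.trans hξ₀))]
    exact (hmono (hξ.trans hξ₀) hξ₀ hξ).trans_lt hlt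
  · rw [hdU ξ hξ.le]
    refine (hVnn ξ hξ.le).lt_of_ne' fun h0 => ?_
    have hUR : R ≤ U ξ := by
      by_contra! hlt
      have := speedBarrier_pos hc (by linarith) hRr (hpos ξ hξ.le) hlt.le
      linarith [hbar ξ hξ.le hlt]
    have hmin : IsLocalMin V ξ := by
      filter_upwards [Iic_mem_nhds hξ] with x hx
      rw [h0]
      exact hVnn x hx
    have := hmin.hasDerivAt_eq_zero (hVat ξ hξ)
    linarith [acceleration_le_neg_one hp hc (hR.trans hUR) h0.ge]

/-! ### Passage to the limit as the starting point tends to the origin. -/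

/-- Trajectories of a bounded Lipschitz field with convergent initial values converge to a
trajectory. -/
lemma exists_tendsto_trajectory {E : Type*} [NormedAddCommGroup E] [NormedSpace ℝ E]
    [CompleteSpace E] {F : E → E} {K : NNReal} {C S : ℝ} (hF : LipschitzWith K F)
    (hC : ∀ z, ‖F z‖ ≤ C) (hS : 0 ≤ S) {w : ℕ → ℝ → E} {z₀ : E}
    (hw : ∀ᶠ n in atTop, ∀ s ∈ Icc 0 S, HasDerivWithinAt (w n) (F (w n s)) (Icc 0 S) s)
    (hw0 : Tendsto (fun n => w n 0) atTop (𝓝 z₀)) :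
    ∃ z : ℝ → E, (∀ s ∈ Icc 0 S, HasDerivWithinAt z (F (z s)) (Icc 0 S) s) ∧
      ∀ s ∈ Icc 0 S, Tendsto (fun n => w n s) atTop (𝓝 (z s)) := by
  obtain ⟨z, hz0, hz⟩ := exists_hasDerivWithinAt_Icc_of_lipschitzWith hF hC hS z₀
  refine ⟨z, hz, fun s hs => ?_⟩
  have hIci : ∀ {f : ℝ → E} {f' : E} {t : ℝ}, t ∈ Ico 0 S → HasDerivWithinAt f f' (Icc 0 S) t →
      HasDerivWithinAt f f' (Ici t) t := fun ht h =>
    h.mono_of_mem_nhdsWithin (Icc_mem_nhdsGE_of_mem ht)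
  rw [tendsto_iff_dist_tendsto_zero]
  have hlim : Tendsto (fun n => dist (w n 0) z₀ * Real.exp (K * (s - 0))) atTop (𝓝 0) := by
    simpa using (tendsto_iff_dist_tendsto_zero.1 hw0).mul_const (Real.exp (K * (s - 0)))
  refine squeeze_zero' (Eventually.of_forall fun n => dist_nonneg) ?_ hlim
  filter_upwards [hw] with n hn
  exact dist_le_of_trajectories_ODE (v := fun _ => F) (fun _ => hF)
    (fun t ht => (hn t ht).continuousWithinAt)
    (fun t ht => hIci ht (hn t (Ico_subset_Icc_self ht)))
    (fun t ht => (hz t ht).continuousWithinAt)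
    (fun t ht => hIci ht (hz t (Ico_subset_Icc_self ht))) (by rw [hz0]) s hs

namespace IsRisingTrajectory

variable {p c a T : ℝ} {u v : ℝ → ℝ}

/-- Integrates `u' ≤ u / c` backwards from the end point. The bound does not involve `a`, so it
keeps the reversed trajectories away from `u = 0` uniformly on compact time intervals. -/
lemma mul_exp_le_fst (h : IsRisingTrajectory p c a T u v) (ha : 0 < a) (hc : 0 < c) {t : ℝ}
    (ht : t ∈ Icc 0 T) : u T * Real.exp (-(c⁻¹ * (T - t))) ≤ u t := by
  have hexp : ∀ t, HasDerivAt (fun t => Real.exp (-(c⁻¹ * t)))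
      (Real.exp (-(c⁻¹ * t)) * -c⁻¹) t := fun t => by
    simpa using ((hasDerivAt_id t).const_mul c⁻¹).neg.exp
  have hanti : AntitoneOn (fun t => u t * Real.exp (-(c⁻¹ * t))) (Icc 0 T) := by
    refine antitoneOn_of_hasDerivWithinAt_nonpos (convex_Icc _ _)
      (f' := fun t => v t * Real.exp (-(c⁻¹ * t)) + u t * (Real.exp (-(c⁻¹ * t)) * -c⁻¹))
      (h.continuousOn_fst.mul (by fun_prop)) (fun s hs => ?_) (fun s hs => ?_)
    · exact ((h.hasDerivWithinAt_fst s (interior_subset hs)).mul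
        (hexp s).hasDerivWithinAt).mono interior_subset
    · have h1 := h.snd_le ha hc (interior_subset hs)
      nlinarith [Real.exp_pos (-(c⁻¹ * s))]
  have := hanti ht ⟨ht.1.trans ht.2, le_rfl⟩ ht.2
  simp only at this
  have e : -(c⁻¹ * (T - t)) = -(c⁻¹ * T) + c⁻¹ * t := by ring
  rw [e, Real.exp_add, ← mul_assoc]
  calc u T * Real.exp (-(c⁻¹ * T)) * Real.exp (c⁻¹ * t)
      ≤ u t * Real.exp (-(c⁻¹ * t)) * Real.exp (c⁻¹ * t) := by gcongr
    _ = u t := by rw [mul_assoc, ← Real.exp_add]; simp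

lemma hasDerivWithinAt_reverse (h : IsRisingTrajectory p c a T u v) {S s : ℝ} (hS : S ≤ T)
    (hs : s ∈ Icc 0 S) : HasDerivWithinAt (fun s => (u (T - s), v (T - s)))
      (-(v (T - s), acceleration p c (u (T - s)) (v (T - s)))) (Icc 0 S) s := by
  have hmem : ∀ x ∈ Icc 0 S, T - x ∈ Icc 0 T := fun x hx =>
    ⟨by linarith [hx.2], by linarith [hx.1]⟩
  have hd : HasDerivWithinAt (fun s => T - s) (-1) (Icc 0 S) s :=
    ((hasDerivAt_id s).const_sub T).hasDerivWithinAt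
  have h1 := (h.hasDerivWithinAt_fst (T - s) (hmem s hs)).scomp s hd hmem
  have h2 := (h.hasDerivWithinAt_snd (T - s) (hmem s hs)).scomp s hd hmem
  simpa [Function.comp_def] using h1.prodMk h2

end IsRisingTrajectory

lemma continuous_speedBarrier (c r R : ℝ) : Continuous (speedBarrier c r R) := by
  unfold speedBarrier
  fun_prop

/-- The profile is the limit of rising trajectories that start ever closer to the origin, run
backwards from their end points on the line `v = 0`. -/
lemma exists_isSpiralProfile {p c r R : ℝ} (hp : 2 < p) (hc : 0 < c) (hc8 : c ≤ 1 / 8)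
    (hr : 0 < r) (hr1 : r ≤ 1) (hrp : r ^ p = 16 * c ^ 2) (hR : 2 ≤ R)
    (hRr : 2 * R ^ 2 + 1 < r / (16 * c)) :
    ∃ U, IsSpiralProfile p c U ∧ R ≤ U 0 ∧
      ∀ ξ ≤ 0, U ξ < R → speedBarrier c r R (U ξ) ≤ derivWithin U (Iic 0) ξ := by
  set B := 2 + 2 * c⁻¹ ^ 2
  have hexist : ∀ n : ℕ, ∃ T u v, 0 ≤ T ∧ IsRisingTrajectory p c (r / (n + 1)) T u v ∧ v T = 0 :=
    fun n => exists_isRisingTrajectory hp hc hc8 hr hr1 hrp (by nlinarith) (by positivity)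
      (div_le_self hr.le (by linarith [(Nat.cast_nonneg n : (0 : ℝ) ≤ n)]))
  choose T u v hT h hvT using hexist
  have ha : ∀ n : ℕ, 0 < r / (n + 1) := fun n => by positivity
  have har : ∀ n : ℕ, r / (n + 1) ≤ r := fun n =>
    div_le_self hr.le (by linarith [(Nat.cast_nonneg n : (0 : ℝ) ≤ n)])
  have hTmem : ∀ n, T n ∈ Icc 0 (T n) := fun n => ⟨hT n, le_rfl⟩
  have hbar : ∀ n, ∀ t ∈ Icc 0 (T n), u n t ≤ R → speedBarrier c r R (u n t) ≤ v n t :=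
    fun n t ht huR => (h n).speedBarrier_le (ha n) hc hc8 hp hr hr1 hrp (har n) (by linarith) hRr
      ht huR
  have hle : ∀ n, ∀ t ∈ Icc 0 (T n), u n t ≤ B := fun n t ht =>
    (h n).fst_le (ha n) (by linarith [har n]) hc (by linarith) ht
  -- The barrier is positive below height `R`, whereas `v` vanishes at the end point.
  have htop : ∀ n, R ≤ u n (T n) := fun n => by
    by_contra! hlt
    have h1 := hbar n _ (hTmem n) hlt.le
    have h2 := speedBarrier_pos hc (by linarith) hRr ((h n).fst_pos (ha n) (hTmem n)) hlt.le
    linarith [hvT n]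
  have hexp : ∀ n, ∀ t ∈ Icc 0 (T n), Real.exp (-(c⁻¹ * (T n - t))) ≤ u n t := fun n t ht =>
    le_trans (le_mul_of_one_le_left (Real.exp_pos _).le (by linarith [htop n]))
      ((h n).mul_exp_le_fst (ha n) hc ht)
  -- The starting height `r / (n + 1)` is at least `exp (-T / c)`, so the running times tend to
  -- infinity.
  have hTlarge : ∀ S, ∀ᶠ n in atTop, S ≤ T n := fun S => by
    have hlim : Tendsto (fun n : ℕ => r / ((n : ℝ) + 1)) atTop (𝓝 0) := by
      simpa [div_eq_mul_inv] using (tendsto_one_div_add_atTop_nhds_zero_nat (𝕜 := ℝ)).const_mul r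
    filter_upwards [hlim.eventually (gt_mem_nhds (Real.exp_pos (-(c⁻¹ * S))))] with n hn
    by_contra! hlt
    have h1 := hexp n 0 ⟨le_rfl, hT n⟩
    rw [(h n).fst_zero, sub_zero] at h1
    have h2 := Real.exp_lt_exp.1 (h1.trans_lt hn)
    have h3 := mul_lt_mul_of_pos_left hlt (inv_pos.2 hc)
    linarith
  obtain ⟨m, hm, φ, hφ, hlim⟩ := (isCompact_Icc (a := R) (b := B)).tendsto_subseq
    (fun n => ⟨htop n, hle n _ (hTmem n)⟩)
  set w : ℕ → ℝ → ℝ × ℝ := fun n s => (u (φ n) (T (φ n) - s), v (φ n) (T (φ n) - s)) with hw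
  have hw0 : Tendsto (fun n => w n 0) atTop (𝓝 (m, 0)) := by
    simp only [hw, sub_zero, hvT]
    exact hlim.prodMk_nhds tendsto_const_nhds
  have hlarge : ∀ S, ∀ᶠ n in atTop, S ≤ T (φ n) := fun S =>
    hφ.tendsto_atTop.eventually (hTlarge S)
  have hbox : ∀ S, ∀ n, S ≤ T (φ n) → ∀ s ∈ Icc 0 S,
      (w n s).1 ∈ Icc (Real.exp (-(c⁻¹ * s))) B ∧ (w n s).2 ∈ Icc 0 (c⁻¹ * (w n s).1) := by
    intro S n hn s hs
    have hmem : T (φ n) - s ∈ Icc 0 (T (φ n)) := ⟨by linarith [hs.2], by linarith [hs.1]⟩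
    have h1 := hexp _ _ hmem
    rw [sub_sub_cancel] at h1
    exact ⟨⟨h1, hle _ _ hmem⟩, (h _).snd_nonneg _ hmem, (h _).snd_le (ha _) hc hmem⟩
  have hB : 1 ≤ B := by
    have : 0 ≤ 2 * c⁻¹ ^ 2 := by positivity
    linarith
  have htraj : ∀ S, 0 ≤ S → ∃ z : ℝ → ℝ × ℝ, (∀ s ∈ Icc 0 S, HasDerivWithinAt z
      (-truncatedField p c (Real.exp (-(c⁻¹ * S))) B (c⁻¹ * B) (z s)) (Icc 0 S) s) ∧
      ∀ s ∈ Icc 0 S, Tendsto (fun n => w n s) atTop (𝓝 (z s)) := by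
    intro S hS
    have hexpS : Real.exp (-(c⁻¹ * S)) ≤ 1 := by
      rw [Real.exp_le_one_iff]
      have : 0 ≤ c⁻¹ * S := by positivity
      linarith
    obtain ⟨K, C, hK, hC⟩ := exists_lipschitzWith_truncatedField p c
      (Real.exp_pos (-(c⁻¹ * S))) (hexpS.trans hB) (b := c⁻¹ * B) (by positivity)
    refine exists_tendsto_trajectory (F := fun z => -truncatedField p c (Real.exp (-(c⁻¹ * S))) B
      (c⁻¹ * B) z) hK.neg (fun z => (norm_neg _).trans_le (hC z)) hS ?_ hw0
    filter_upwards [hlarge S] with n hn s hs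
    obtain ⟨⟨h1, h2⟩, h3, h4⟩ := hbox S n hn s hs
    have h5 : Real.exp (-(c⁻¹ * S)) ≤ Real.exp (-(c⁻¹ * s)) := by
      rw [Real.exp_le_exp]
      have := mul_le_mul_of_nonneg_left hs.2 (inv_pos.2 hc).le
      linarith
    have h6 : c⁻¹ * (w n s).1 ≤ c⁻¹ * B := mul_le_mul_of_nonneg_left h2 (inv_pos.2 hc).le
    have := (h (φ n)).hasDerivWithinAt_reverse hn hs
    rwa [← truncatedField_eq ⟨h5.trans h1, h2⟩ ⟨h3, h4.trans h6⟩] at this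
  have hlimit : ∀ s, ∃ l, 0 ≤ s → Tendsto (fun n => w n s) atTop (𝓝 l) := fun s => by
    by_cases hs : 0 ≤ s
    · obtain ⟨z, -, hz⟩ := htraj s hs
      exact ⟨z s, fun _ => hz s ⟨hs, le_rfl⟩⟩
    · exact ⟨0, fun hs' => absurd hs' hs⟩
  choose Z hZ using hlimit
  have hZ1 : ∀ s, 0 ≤ s → Tendsto (fun n => (w n s).1) atTop (𝓝 (Z s).1) := fun s hs =>
    (continuous_fst.tendsto _).comp (hZ s hs)
  have hZ2 : ∀ s, 0 ≤ s → Tendsto (fun n => (w n s).2) atTop (𝓝 (Z s).2) := fun s hs =>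
    (continuous_snd.tendsto _).comp (hZ s hs)
  have hZbox : ∀ s, 0 ≤ s →
      (Z s).1 ∈ Icc (Real.exp (-(c⁻¹ * s))) B ∧ (Z s).2 ∈ Icc 0 (c⁻¹ * (Z s).1) := by
    intro s hs
    have hev : ∀ᶠ n in atTop,
        (w n s).1 ∈ Icc (Real.exp (-(c⁻¹ * s))) B ∧ (w n s).2 ∈ Icc 0 (c⁻¹ * (w n s).1) := by
      filter_upwards [hlarge s] with n hn using hbox s n hn s ⟨hs, le_rfl⟩
    exact ⟨⟨ge_of_tendsto (hZ1 s hs) (hev.mono fun n hn => hn.1.1),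
      le_of_tendsto (hZ1 s hs) (hev.mono fun n hn => hn.1.2)⟩,
      ge_of_tendsto (hZ2 s hs) (hev.mono fun n hn => hn.2.1),
      le_of_tendsto_of_tendsto (hZ2 s hs) ((hZ1 s hs).const_mul _) (hev.mono fun n hn => hn.2.2)⟩
  have hZbar : ∀ s, 0 ≤ s → (Z s).1 < R → speedBarrier c r R (Z s).1 ≤ (Z s).2 := by
    intro s hs hlt
    refine le_of_tendsto_of_tendsto (((continuous_speedBarrier c r R).tendsto _).comp (hZ1 s hs))
      (hZ2 s hs) ?_
    filter_upwards [hlarge s, (hZ1 s hs).eventually (gt_mem_nhds hlt)] with n hn hn'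
    exact hbar _ _ ⟨by linarith, by linarith⟩ hn'.le
  have hZder : ∀ s, 0 ≤ s →
      HasDerivWithinAt Z (-((Z s).2, acceleration p c (Z s).1 (Z s).2)) (Ici 0) s := by
    intro s hs
    -- The extra unit of time makes `[0, s + 1]` a neighbourhood of `s` in `[0, ∞)`.
    obtain ⟨z, hz, hz'⟩ := htraj (s + 1) (by linarith)
    have heq : ∀ x ∈ Icc 0 (s + 1), Z x = z x := fun x hx =>
      tendsto_nhds_unique (hZ x hx.1) (hz' x hx)
    have hsmem : s ∈ Icc 0 (s + 1) := ⟨hs, by linarith⟩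
    have hd := (hz s hsmem).congr heq (heq s hsmem)
    obtain ⟨⟨h1, h2⟩, h3, h4⟩ := hZbox s hs
    have h5 : Real.exp (-(c⁻¹ * (s + 1))) ≤ Real.exp (-(c⁻¹ * s)) := by
      rw [Real.exp_le_exp]
      have := inv_pos.2 hc
      linarith
    have h6 : c⁻¹ * (Z s).1 ≤ c⁻¹ * B := mul_le_mul_of_nonneg_left h2 (inv_pos.2 hc).le
    rw [← heq s hsmem, truncatedField_eq ⟨h5.trans h1, h2⟩ ⟨h3, h4.trans h6⟩] at hd
    refine hd.mono_of_mem_nhdsWithin ?_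
    rw [← Ici_inter_Iic]
    exact inter_mem_nhdsWithin _ (Iic_mem_nhds (by linarith))
  have hZ0 : Z 0 = (m, 0) := tendsto_nhds_unique (hZ 0 le_rfl) hw0
  have hneg : ∀ ξ ∈ Iic (0 : ℝ), -ξ ∈ Ici (0 : ℝ) := fun ξ hξ => mem_Ici.2 (neg_nonneg.2 hξ)
  have hder : ∀ ξ ≤ 0, HasDerivWithinAt (fun ξ => Z (-ξ))
      ((Z (-ξ)).2, acceleration p c (Z (-ξ)).1 (Z (-ξ)).2) (Iic 0) ξ := fun ξ hξ => by
    have := (hZder (-ξ) (neg_nonneg.2 hξ)).scomp ξ (hasDerivAt_neg ξ).hasDerivWithinAt hneg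
    simpa [Function.comp_def] using this
  have hU : ∀ ξ ≤ 0, HasDerivWithinAt (fun ξ => (Z (-ξ)).1) (Z (-ξ)).2 (Iic 0) ξ := fun ξ hξ =>
    (ContinuousLinearMap.fst ℝ ℝ ℝ).hasFDerivAt.comp_hasDerivWithinAt ξ (hder ξ hξ)
  have hV : ∀ ξ ≤ 0, HasDerivWithinAt (fun ξ => (Z (-ξ)).2)
      (acceleration p c (Z (-ξ)).1 (Z (-ξ)).2) (Iic 0) ξ := fun ξ hξ =>
    (ContinuousLinearMap.snd ℝ ℝ ℝ).hasFDerivAt.comp_hasDerivWithinAt ξ (hder ξ hξ)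
  refine ⟨fun ξ => (Z (-ξ)).1, ?_, by simpa [hZ0] using hm.1, fun ξ hξ hlt => ?_⟩
  · exact isSpiralProfile_of_speedBarrier_le (V := fun ξ => (Z (-ξ)).2) (by linarith) hc hR hRr
      hU hV (fun ξ hξ => (Real.exp_pos _).trans_le (hZbox _ (neg_nonneg.2 hξ)).1.1)
      (fun ξ hξ => (hZbox _ (neg_nonneg.2 hξ)).2.1) (fun ξ hξ => (hZbox _ (neg_nonneg.2 hξ)).2.2)
      (by simp [hZ0]) (fun ξ hξ => hZbar _ (neg_nonneg.2 hξ))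
  · rw [(hU ξ hξ).derivWithin (uniqueDiffOn_Iic 0 ξ hξ)]
    exact hZbar _ (neg_nonneg.2 hξ) hlt

/-! ### Small speeds and the theorem. -/

lemma tendsto_rpow_div_atTop {p : ℝ} (hp : 2 < p) :
    Tendsto (fun c : ℝ => (16 * c ^ 2) ^ p⁻¹ / (16 * c)) (𝓝[>] 0) atTop := by
  have hexp : 2 * p⁻¹ - 1 < 0 := by
    have : 2 * p⁻¹ < 1 := by
      rw [← div_eq_mul_inv, div_lt_one (by linarith)]
      exact hp
    linarith
  have h16 : (0 : ℝ) < 16 ^ p⁻¹ / 16 := by positivity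
  refine ((tendsto_rpow_neg_nhdsGT_zero hexp).const_mul_atTop h16).congr' ?_
  filter_upwards [self_mem_nhdsWithin] with c hc
  have hc : 0 < c := hc
  rw [Real.mul_rpow (by norm_num) (by positivity), Real.rpow_sub hc, Real.rpow_one,
    Real.rpow_mul hc.le, Real.rpow_two]
  field_simp

/-- For small speeds the profile exists, is high, and is steep at intermediate heights. -/
lemma exists_forall_exists_isSpiralProfile {p : ℝ} (hp : 2 < p) {R δ A : ℝ} (hR : 2 ≤ R)
    (hδ : 0 < δ) (hA : 0 < A) : ∃ c₁ : ℝ, 0 < c₁ ∧ ∀ c ∈ Ioo 0 c₁, ∃ U, IsSpiralProfile p c U ∧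
      R ≤ U 0 ∧ ∀ ξ ≤ 0, δ ≤ U ξ → U ξ < R → A < derivWithin U (Iic 0) ξ := by
  -- The drop of the barrier between heights `1` and `R` is below `2 R ^ 2`, so a speed above `A`
  -- remains; `c < δ / (8 A)` gives `u / (8 c) > A` for `u ≥ δ`.
  have h1 : ∀ᶠ c : ℝ in 𝓝[>] 0, 2 * R ^ 2 + 1 + A < (16 * c ^ 2) ^ p⁻¹ / (16 * c) :=
    (tendsto_rpow_div_atTop hp).eventually_gt_atTop _
  have h2 : ∀ᶠ c : ℝ in 𝓝[>] 0, c < min (1 / 8) (δ / (8 * A)) :=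
    nhdsWithin_le_nhds (Iio_mem_nhds (by positivity))
  obtain ⟨c₁, hc₁, hsub⟩ := mem_nhdsGT_iff_exists_Ioo_subset.1 (h1.and h2)
  refine ⟨c₁, hc₁, fun c hc => ?_⟩
  obtain ⟨hQ, hlt⟩ := hsub hc
  have hc0 : 0 < c := hc.1
  have hc8 : c ≤ 1 / 8 := (hlt.trans_le (min_le_left _ _)).le
  have hcδ : c < δ / (8 * A) := hlt.trans_le (min_le_right _ _)
  have hr1 : (16 * c ^ 2) ^ p⁻¹ ≤ 1 :=
    Real.rpow_le_one (by positivity) (by nlinarith) (by positivity)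
  obtain ⟨U, hU, hUR, hbar⟩ := exists_isSpiralProfile (r := (16 * c ^ 2) ^ p⁻¹) hp hc0 hc8
    (by positivity) hr1 (Real.rpow_inv_rpow (by positivity) (by linarith)) hR (by linarith)
  refine ⟨U, hU, hUR, fun ξ hξ hδU hUlt => lt_of_lt_of_le (lt_min ?_ ?_) (hbar ξ hξ hUlt)⟩
  · rw [lt_div_iff₀ (by positivity)]
    rw [lt_div_iff₀ (by positivity)] at hcδ
    linarith
  · have : max (U ξ - 1) 0 ≤ R := max_le (by linarith) (by linarith)
    nlinarith

theorem theorem3p5 (p : ℝ) (hp : 2 < p) :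
    ∃ c₀ : ℝ, 0 < c₀ ∧ ∃ U : ℝ → ℝ → ℝ,
      (∀ c ∈ Ioo 0 c₀,
        IsSpiralProfile p c (U c) ∧
        (∃ L : ℝ, 0 < L ∧ ∀ ξ ≤ 0, derivWithin (U c) (Iic 0) ξ ≤ L * U c ξ) ∧
        ∀ V : ℝ → ℝ, IsSpiralProfile p c V → EqOn V (U c) (Iic 0)) ∧
      StrictAntiOn (fun c => U c 0) (Ioo 0 c₀) ∧
      Tendsto (fun c => U c 0) (𝓝[>] 0) atTop ∧
      ∀ δ > 0, ∀ A > 0, ∃ c₁ : ℝ, 0 < c₁ ∧ c₁ ≤ c₀ ∧ ∀ c ∈ Ioo 0 c₁,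
        δ⁻¹ < U c 0 ∧
        ∀ ξ ≤ 0, δ ≤ U c ξ → U c ξ ≤ δ⁻¹ → A < derivWithin (U c) (Iic 0) ξ := by
  obtain ⟨c₀, hc₀, hex⟩ := exists_forall_exists_isSpiralProfile hp le_rfl one_pos one_pos
  have hex' : ∀ c, ∃ U, c ∈ Ioo 0 c₀ → IsSpiralProfile p c U ∧ 2 ≤ U 0 := fun c => by
    by_cases hc : c ∈ Ioo 0 c₀
    · obtain ⟨U, hU, h2, -⟩ := hex c hc
      exact ⟨U, fun _ => ⟨hU, h2⟩⟩
    · exact ⟨0, fun h => absurd h hc⟩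
  choose U hU using hex'
  have hsteep : ∀ δ > 0, ∀ A > 0, ∃ c₁ : ℝ, 0 < c₁ ∧ c₁ ≤ c₀ ∧ ∀ c ∈ Ioo 0 c₁,
      δ⁻¹ < U c 0 ∧
      ∀ ξ ≤ 0, δ ≤ U c ξ → U c ξ ≤ δ⁻¹ → A < derivWithin (U c) (Iic 0) ξ := by
    intro δ hδ A hA
    have hδ' : 0 < δ⁻¹ := inv_pos.2 hδ
    -- The barrier needs `R ≥ 2` and heights strictly below `R`; both hold with `δ⁻¹ + 2`. The
    -- resulting profile depends on `δ` and `A`, and uniqueness identifies it with `U c`.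
    obtain ⟨c₁, hc₁, h₁⟩ := exists_forall_exists_isSpiralProfile hp (R := δ⁻¹ + 2) (by linarith)
      hδ hA
    refine ⟨min c₁ c₀, lt_min hc₁ hc₀, min_le_right _ _, fun c hc => ?_⟩
    obtain ⟨V, hV, hVR, hVA⟩ := h₁ c ⟨hc.1, hc.2.trans_le (min_le_left _ _)⟩
    have heq : EqOn V (U c) (Iic 0) :=
      hV.eqOn (hU c ⟨hc.1, hc.2.trans_le (min_le_right _ _)⟩).1 hc.1
    refine ⟨by linarith [heq self_mem_Iic], fun ξ hξ h1 h2 => ?_⟩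
    rw [← heq hξ] at h1 h2
    rw [← derivWithin_congr heq (heq hξ)]
    exact hVA ξ hξ h1 (by linarith)
  refine ⟨c₀, hc₀, U, fun c hc => ⟨(hU c hc).1,
    ⟨c⁻¹, inv_pos.2 hc.1, fun ξ hξ => (hU c hc).1.derivWithin_le hc.1 hξ⟩,
    fun V hV => hV.eqOn (hU c hc).1 hc.1⟩, ?_, ?_, hsteep⟩
  · intro c hc d hd hcd
    exact (hU c hc).1.top_lt_top (hU d hd).1 (by linarith) hc.1 hcd (by linarith [(hU c hc).2])
  · refine tendsto_atTop.2 fun N => ?_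
    have hN : 0 < max N 1 := lt_max_of_lt_right one_pos
    obtain ⟨c₁, hc₁, -, h₁⟩ := hsteep (max N 1)⁻¹ (inv_pos.2 hN) 1 one_pos
    filter_upwards [Ioo_mem_nhdsGT hc₁] with c hc
    have := (h₁ c hc).1
    rw [inv_inv] at this
    exact (le_max_left _ _).trans this.le
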